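/- Let $m\ge 3$, let $U$ be a smooth $m$-manifold (for instance an open subset of a given $m$-manifold) and let $f\colon U\to\mathbf R^{m+1}$ be a front: $f$ is $C^\infty$, and each point of $U$ has a neighbourhood on which there is a smooth unit vector field $\nu$ along $f$ with $\langle df(X),\nu\rangle=0$ for all tangent vectors $X$, such that $(f,\nu)$ is an immersion into the unit tangent bundle $\mathbf R^{m+1}\times S^m$. Let $\Sigma_f$ be the singular set of $f$, that is, the set of points $p$ at which $df_p$ is not injective. Suppose that every $p\in\Sigma_f$ is an $A_2$-point: the function $\lambda=\det(\partial_1 f,\dots,\partial_m f,\nu)$, formed in local coordinates at $p$, satisfies $d\lambda(p)\ne 0$ (so that near $p$ the set $\Sigma_f$ is an $(m-1)$-dimensional submanifold), and the null direction $\ker df_p$ is transversal to $\Sigma_f$ at $p$. Then $\Sigma_f$ is a smooth $(m-1)$-dimensional submanifold of $U$ (the singular submanifold), the metric $ds^2=f^*\langle\ ,\ \rangle$ induced by $f$ is positive definite on $\Sigma_f$, and the following hold, where $K$ denotes the sectional curvature of $ds^2$ on the regular set $U\setminus\Sigma_f$, and the sectional curvature of $\Sigma_f$ is that of the restriction of $ds^2$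 to $\Sigma_f$. 1. If $K>0$ for all tangent planes at all points of $U\setminus\Sigma_f$, then the sectional curvature of $\Sigma_f$ is non-negative. 2. If there is a constant $\delta>0$ such that $K\ge\delta$ for all tangent planes at all points of $U\setminus\Sigma_f$, then the sectional curvature of $\Sigma_f$ is positive. More generally, the sectional curvature of $\Sigma_f$ is positive if each $p\in\Sigma_f$ has an open neighbourhood $O$ with a smooth vector field $\tilde\eta$ on $O$ and a constant $\delta>0$ such that $\tilde\eta\neq0$ and $df(\tilde\eta)=0$ at all points of $O\cap\Sigma_f$, and $K(X\wedge\tilde\eta)\ge\delta$ for every tangent vector $X$ linearly independent of $\tilde\eta$ at a point of $O\setminus\Sigma_f$. -/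

import Mathlib

open scoped Manifold ContDiff

noncomputable section

namespace WaveFront

/-- Euclidean space `ℝⁿ`. -/
abbrev Euc (n : ℕ) : Type := EuclideanSpace ℝ (Fin n)

/-- The `i`-th standard basis vector of `ℝⁿ`. -/
def stdVec {n : ℕ} (i : Fin n) : Euc n := EuclideanSpace.single i 1

/-! ### Sectional curvature of a Riemannian metric in coordinates -/

/-- The partial derivative `∂ᵢ h` at `u`. -/
def pderiv {n : ℕ} (i : Fin n) (h : Euc n → ℝ) (u : Euc n) : ℝ :=
  fderiv ℝ h u (stdVec i)

/-- The Christoffel symbol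
`Γᵏᵢⱼ = ½ ∑ₗ gᵏˡ (∂ᵢ gⱼₗ + ∂ⱼ gᵢₗ - ∂ₗ gᵢⱼ)` of the metric `g = (gᵢⱼ)`. -/
def christoffel {n : ℕ} (g : Euc n → Matrix (Fin n) (Fin n) ℝ) (k i j : Fin n)
    (u : Euc n) : ℝ :=
  (1 / 2 : ℝ) * ∑ l, (g u)⁻¹ k l *
    (pderiv i (fun v => g v j l) u + pderiv j (fun v => g v i l) u
      - pderiv l (fun v => g v i j) u)

/-- The components of the curvature tensor
`R(∂ᵢ, ∂ⱼ)∂ₖ = ∇ᵢ∇ⱼ∂ₖ - ∇ⱼ∇ᵢ∂ₖ = ∑ₗ Rˡₖᵢⱼ ∂ₗ` of the Levi-Civita connection of `g`. -/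
def riemann {n : ℕ} (g : Euc n → Matrix (Fin n) (Fin n) ℝ) (l k i j : Fin n)
    (u : Euc n) : ℝ :=
  pderiv i (christoffel g l j k) u - pderiv j (christoffel g l i k) u
    + ∑ a, (christoffel g l i a u * christoffel g a j k u
        - christoffel g l j a u * christoffel g a i k u)

/-- The inner product `g(X, Y)` at `u`. -/
def metricInner {n : ℕ} (g : Euc n → Matrix (Fin n) (Fin n) ℝ) (u X Y : Euc n) : ℝ :=
  ∑ i, ∑ j, g u i j * X i * Y j

/-- The sectional curvature
`K(X ∧ Y) = g(R(X, Y)Y, X) / (g(X, X) g(Y, Y) - g(X, Y)²)` of the metric `g` at `u`. -/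
def sectionalCurvature {n : ℕ} (g : Euc n → Matrix (Fin n) (Fin n) ℝ)
    (u X Y : Euc n) : ℝ :=
  (∑ i, ∑ j, ∑ k, ∑ l, ∑ s, g u l s * riemann g l k i j u * X i * Y j * Y k * X s) /
    (metricInner g u X X * metricInner g u Y Y - metricInner g u X Y ^ 2)

/-- The pull-back `F^*⟨ , ⟩` of the Euclidean metric by `F : ℝⁿ → ℝᴺ`. -/
def pullbackMetric {n N : ℕ} (F : Euc n → Euc N) (u : Euc n) : Matrix (Fin n) (Fin n) ℝ :=
  Matrix.of fun i j => inner ℝ (fderiv ℝ F u (stdVec i)) (fderiv ℝ F u (stdVec j))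

/-! ### Submanifolds and the curvature of the induced metric -/

section Manifold

variable {m : ℕ} {M : Type*} [TopologicalSpace M] [ChartedSpace (Euc m) M]

/-- `γ : W → S` is a local parametrization of the subset `S` of `M` as a `k`-dimensional smooth
submanifold: `W ⊆ ℝᵏ` is open, `γ` is a smooth immersion on `W`, and it is a homeomorphism of
`W` onto a relatively open subset of `S`. -/
structure IsLocalParam (m : ℕ) {M : Type*} [TopologicalSpace M] [ChartedSpace (Euc m) M]
    (k : ℕ) (S : Set M) (W : Set (Euc k)) (γ : Euc k → M) : Prop where
  isOpen : IsOpen W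
  smooth : ContMDiffOn (𝓡 k) (𝓡 m) ∞ γ W
  immersion : ∀ w ∈ W, Function.Injective (mfderiv (𝓡 k) (𝓡 m) γ w)
  embedding : Topology.IsEmbedding (W.domRestrict γ)
  image : ∃ O : Set M, IsOpen O ∧ γ '' W = S ∩ O

/-- `S` is a `k`-dimensional smooth (embedded) submanifold of `M`. -/
def IsSubmanifold (m : ℕ) {M : Type*} [TopologicalSpace M] [ChartedSpace (Euc m) M]
    (k : ℕ) (S : Set M) : Prop :=
  ∀ p ∈ S, ∃ (W : Set (Euc k)) (γ : Euc k → M), IsLocalParam m k S W γ ∧ p ∈ γ '' W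

/-- The metric induced by `f : M → ℝᵐ⁺¹` on the `k`-dimensional submanifold `S` of `M` is positive
definite, that is, the restriction of `f` to `S` is an immersion. -/
def InducedMetricPosDef (f : M → Euc (m + 1)) (k : ℕ) (S : Set M) : Prop :=
  ∀ (W : Set (Euc k)) (γ : Euc k → M), IsLocalParam m k S W γ → ∀ w ∈ W,
    Function.Injective (fderiv ℝ (f ∘ γ) w)

/-- Every value of the sectional curvature of the metric induced by `f : M → ℝᵐ⁺¹` on the
`k`-dimensional submanifold `S` of `M` satisfies `P`. -/
def SectionalCurvatureOn (f : M → Euc (m + 1)) (k : ℕ) (S : Set M) (P : ℝ → Prop) : Prop :=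
  ∀ (W : Set (Euc k)) (γ : Euc k → M), IsLocalParam m k S W γ → ∀ w ∈ W, ∀ X Y : Euc k,
    LinearIndependent ℝ ![X, Y] → P (sectionalCurvature (pullbackMetric (f ∘ γ)) w X Y)

/-! ### Fronts and their singular points -/

/-- `ν` is a smooth unit normal vector field along `f` on `U`. -/
structure IsUnitNormal (f ν : M → Euc (m + 1)) (U : Set M) : Prop where
  smooth : ContMDiffOn (𝓡 m) (𝓡 (m + 1)) ∞ ν U
  unit : ∀ x ∈ U, ‖ν x‖ = 1
  normal : ∀ x ∈ U, ∀ X : TangentSpace (𝓡 m) x,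
    inner (E := Euc (m + 1)) ℝ (mfderiv (𝓡 m) (𝓡 (m + 1)) f x X) (ν x) = 0

/-- `f : Mᵐ → ℝᵐ⁺¹` is a (wave) front: it is smooth, and locally it has a unit normal vector
field `ν` for which `(f, ν)`, as a map into the unit tangent bundle
`T₁ℝᵐ⁺¹ = ℝᵐ⁺¹ × Sᵐ ⊆ ℝᵐ⁺¹ × ℝᵐ⁺¹`, is an immersion. -/
def IsFront (f : M → Euc (m + 1)) : Prop :=
  ContMDiff (𝓡 m) (𝓡 (m + 1)) ∞ f ∧
  ∀ p : M, ∃ (U : Set M) (ν : M → Euc (m + 1)), IsOpen U ∧ p ∈ U ∧ IsUnitNormal f ν U ∧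
    ∀ x ∈ U, Function.Injective
      (mfderiv (𝓡 m) 𝓘(ℝ, Euc (m + 1) × Euc (m + 1)) (fun y => (f y, ν y)) x)

/-- The singular set of `f`: the points where `df` is not injective. -/
def singularSet (f : M → Euc (m + 1)) : Set M :=
  {p | ¬ Function.Injective (mfderiv (𝓡 m) (𝓡 (m + 1)) f p)}

/-- The Jacobian function `λ = det(∂₁f, …, ∂ₘf, ν)` in the coordinates of the chart at `p`. -/
def jacobianFunction (f ν : M → Euc (m + 1)) (p : M) (u : Euc m) : ℝ :=
  Matrix.det (Matrix.of fun i j : Fin (m + 1) =>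
    (Fin.snoc (α := fun _ => Euc (m + 1))
      (fun a : Fin m => fderiv ℝ (f ∘ (extChartAt (𝓡 m) p).symm) u (stdVec a))
      (ν ((extChartAt (𝓡 m) p).symm u)) i) j)

/-- The singular point `p` is non-degenerate: `dλ ≠ 0` at `p`. -/
def IsNonDegenerate (f : M → Euc (m + 1)) (p : M) : Prop :=
  p ∈ singularSet f ∧
  ∃ (U : Set M) (ν : M → Euc (m + 1)), IsOpen U ∧ p ∈ U ∧ IsUnitNormal f ν U ∧
    fderiv ℝ (jacobianFunction f ν p) (extChartAt (𝓡 m) p p) ≠ 0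

/-- `p` is an `A₂`-point of `f`: a non-degenerate singular point (near which, therefore, the
singular set is an `(m-1)`-dimensional submanifold) at which the null direction `ker df` is
transversal to the singular submanifold. -/
def IsA2Point (f : M → Euc (m + 1)) (p : M) : Prop :=
  IsNonDegenerate f p ∧
  ∀ (W : Set (Euc (m - 1))) (γ : Euc (m - 1) → M), IsLocalParam m (m - 1) (singularSet f) W γ →
    ∀ w ∈ W, γ w = p →
      IsCompl (LinearMap.ker (mfderiv (𝓡 m) (𝓡 (m + 1)) f (γ w)).toLinearMap)
        (LinearMap.range (mfderiv (𝓡 (m - 1)) (𝓡 m) γ w).toLinearMap)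

/-- `η` is a smooth vector field on `O` whose restriction to the singular set is a
(non-vanishing) null vector field. -/
structure IsExtendedNullField [IsManifold (𝓡 m) ∞ M] (f : M → Euc (m + 1)) (O : Set M)
    (η : ∀ x : M, TangentSpace (𝓡 m) x) : Prop where
  smooth : ContMDiffOn (𝓡 m) (𝓡 m).tangent ∞
    (fun x => (⟨x, η x⟩ : TangentBundle (𝓡 m) M)) O
  ne_zero : ∀ x ∈ O ∩ singularSet f, η x ≠ 0
  null : ∀ x ∈ O ∩ singularSet f, mfderiv (𝓡 m) (𝓡 (m + 1)) f x (η x) = 0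

/-- At the regular points in `O`, the sectional curvature of the induced metric is at least `δ`
on every tangent plane that contains `η`.  (`Z` is the coordinate expression of `η`.) -/
def NullCurvatureGE (f : M → Euc (m + 1)) (O : Set M)
    (η : ∀ x : M, TangentSpace (𝓡 m) x) (δ : ℝ) : Prop :=
  ∀ (W : Set (Euc m)) (γ : Euc m → M), IsLocalParam m m (singularSet f)ᶜ W γ →
    ∀ w ∈ W, γ w ∈ O → ∀ X Z : Euc m, mfderiv (𝓡 m) (𝓡 m) γ w Z = η (γ w) →
      LinearIndependent ℝ ![X, Z] →
        δ ≤ sectionalCurvature (pullbackMetric (f ∘ γ)) w X Z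

end Manifold

end WaveFront

end

open WaveFront

/-!
Near an `A₂`-point, let `c` parametrize the singular set, let `η` be a null vector and `n = dν(η)`.
By the immersion property of `(f, ν)`, the normal space of `f ∘ c` is spanned by `ν` and `n`.
Restrict the Gauss equation `K(X, Z) |X ∧ Z|² = II(X, X) II(Z, Z) - II(X, Z)²` of `f` to the line
through the singular point in the direction `η`, where `Z` extends `η` and `X` extends a vector
tangent to the singular set. The factor `II(Z, Z)` vanishes to exactly first order, because the
derivative of the Jacobian along `η` is not zero, and `|X ∧ Z|²` to second order. If `K ≥ δ ≥ 0`,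
the sign change of `II(Z, Z)` forces `II(X, X) = 0` at the singular point, and division by `t²`
shows that `⟨D²(f ∘ c)(X, X), n⟩`, up to a sign independent of `X`, is at least a positive multiple
of `δ`. So the second fundamental form of `f ∘ c` is `n` times a semidefinite (definite, if
`δ > 0`) form, and the Gauss equation of `f ∘ c` gives the sign of its sectional curvature.
-/

namespace WaveFront

open Filter Topology

section Matrix

variable {𝕜 E ι : Type*} [NontriviallyNormedField 𝕜] [NormedAddCommGroup E] [NormedSpace 𝕜 E]
  [Fintype ι] [DecidableEq ι] {r : WithTop ℕ∞} {A : E → Matrix ι ι 𝕜} {u : E}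

lemma contDiffAt_matrix_det (hA : ∀ i j, ContDiffAt 𝕜 r (fun v => A v i j) u) :
    ContDiffAt 𝕜 r (fun v => (A v).det) u := by
  simp only [Matrix.det_apply, Units.smul_def, zsmul_eq_mul]
  exact ContDiffAt.sum fun σ _ => contDiffAt_const.mul (contDiffAt_prod fun i _ => hA _ _)

lemma contDiffAt_matrix_adjugate (hA : ∀ i j, ContDiffAt 𝕜 r (fun v => A v i j) u) (i j : ι) :
    ContDiffAt 𝕜 r (fun v => (A v).adjugate i j) u := by
  simp only [Matrix.adjugate_apply]
  refine contDiffAt_matrix_det fun a b => ?_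
  obtain rfl | h := eq_or_ne a j
  · simpa only [Matrix.updateRow_self] using contDiffAt_const
  · simpa only [Matrix.updateRow_ne h] using hA a b

lemma contDiffAt_matrix_inv (hA : ∀ i j, ContDiffAt 𝕜 r (fun v => A v i j) u)
    (hu : (A u).det ≠ 0) (i j : ι) : ContDiffAt 𝕜 r (fun v => (A v)⁻¹ i j) u := by
  simp only [Matrix.inv_def, Ring.inverse_eq_inv', Matrix.smul_apply, smul_eq_mul]
  exact ((contDiffAt_matrix_det hA).inv hu).mul (contDiffAt_matrix_adjugate hA i j)

end Matrix

section SecondDerivative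

variable {E G : Type*} [NormedAddCommGroup E] [NormedSpace ℝ E] [NormedAddCommGroup G]

section NormedSpace

variable [NormedSpace ℝ G] {g : E → G} {u : E}

lemma differentiableAt_fderiv (hg : ContDiffAt ℝ 2 g u) : DifferentiableAt ℝ (fderiv ℝ g) u :=
  (hg.fderiv_right (m := 1) (by norm_num)).differentiableAt one_ne_zero

lemma differentiableAt_fderiv_apply (hg : ContDiffAt ℝ 2 g u) (X : E) :
    DifferentiableAt ℝ (fun v => fderiv ℝ g v X) u :=
  (differentiableAt_fderiv hg).clm_apply (differentiableAt_const X)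

lemma fderiv_fderiv_apply (hg : ContDiffAt ℝ 2 g u) (X Y : E) :
    fderiv ℝ (fun v => fderiv ℝ g v X) u Y = fderiv ℝ (fderiv ℝ g) u Y X := by
  simp [fderiv_clm_apply (differentiableAt_fderiv hg) (differentiableAt_const X)]

lemma fderiv_fderiv_comm (hg : ContDiffAt ℝ 2 g u) (X Y : E) :
    fderiv ℝ (fderiv ℝ g) u X Y = fderiv ℝ (fderiv ℝ g) u Y X :=
  hg.isSymmSndFDerivAt (by simp) X Y

end NormedSpace

variable [InnerProductSpace ℝ G] {g : E → G} {u : E}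

/-- The component in the direction `v` of the second fundamental form of `g` at `u`: the bilinear
form `(X, Y) ↦ ⟨D²g(X, Y), v⟩`, for a normal vector `v`. -/
noncomputable def secondForm (g : E → G) (u : E) (v : G) : LinearMap.BilinForm ℝ E :=
  LinearMap.mk₂ ℝ (fun X Y => inner ℝ (fderiv ℝ (fderiv ℝ g) u X Y) v)
    (by simp [inner_add_left]) (by simp [real_inner_smul_left])
    (by simp [inner_add_left]) (by simp [real_inner_smul_left])

lemma secondForm_apply (v : G) (X Y : E) :
    secondForm g u v X Y = inner ℝ (fderiv ℝ (fderiv ℝ g) u X Y) v := rfl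

lemma isSymm_secondForm (hg : ContDiffAt ℝ 2 g u) (v : G) : LinearMap.IsSymm (secondForm g u v) :=
  ⟨fun X Y => by rw [RingHom.id_apply, secondForm_apply, fderiv_fderiv_comm hg, secondForm_apply]⟩

end SecondDerivative

lemma tendsto_inv_smul_of_hasDerivAt {G : Type*} [NormedAddCommGroup G] [NormedSpace ℝ G]
    {y : ℝ → G} {y' : G} (hy : HasDerivAt y y' 0) (hy0 : y 0 = 0) :
    Tendsto (fun t : ℝ => t⁻¹ • y t) (𝓝[≠] 0) (𝓝 y') := by
  simpa [hy0] using hasDerivAt_iff_tendsto_slope_zero.1 hy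

section GramDet

variable {G : Type*} [NormedAddCommGroup G] [InnerProductSpace ℝ G]

/-- The Gram determinant of two vectors, the square of the area they span. -/
def gramDet (x y : G) : ℝ := inner ℝ x x * inner ℝ y y - inner ℝ x y ^ 2

lemma gramDet_pos {x y : G} (h : LinearIndependent ℝ ![x, y]) : 0 < gramDet x y :=
  sub_pos.2 ((LinearMap.BilinForm.apply_sq_lt_iff_linearIndependent_of_symm (innerₗ G)
    (fun _ hx => real_inner_self_pos.2 hx) ⟨fun x y => real_inner_comm y x⟩ x y).2 h)

lemma gramDet_map_pos {V : Type*} [AddCommGroup V] [Module ℝ V] {L : V →ₗ[ℝ] G}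
    (hL : Function.Injective L) {x y : V} (h : LinearIndependent ℝ ![x, y]) :
    0 < gramDet (L x) (L y) := by
  refine gramDet_pos ?_
  have hmap := h.map' L (LinearMap.ker_eq_bot.2 hL)
  rwa [← FinVec.map_eq] at hmap

lemma tendsto_gramDet_div_sq {x y : ℝ → G} {y' : G} (hx : ContinuousAt x 0)
    (hy : HasDerivAt y y' 0) (hy0 : y 0 = 0) :
    Tendsto (fun t => gramDet (x t) (y t) / t ^ 2) (𝓝[≠] 0) (𝓝 (gramDet (x 0) y')) := by
  have hslope := tendsto_inv_smul_of_hasDerivAt hy hy0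
  have hx' := hx.tendsto.mono_left (nhdsWithin_le_nhds (s := {0}ᶜ))
  refine (((hx'.inner hx').mul (hslope.inner hslope)).sub ((hx'.inner hslope).pow 2)).congr' ?_
  filter_upwards [self_mem_nhdsWithin] with t (ht : t ≠ 0)
  simp only [gramDet, real_inner_smul_left, real_inner_smul_right]
  field_simp

end GramDet

section Gauss

variable {n N : ℕ} {F : Euc n → Euc N} {u : Euc n}

lemma sum_smul_stdVec (X : Euc n) : ∑ i, X i • stdVec i = X := by
  simpa [stdVec] using (EuclideanSpace.basisFun (Fin n) ℝ).sum_repr X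

lemma map_eq_sum_stdVec {V : Type*} [AddCommGroup V] [Module ℝ V] [TopologicalSpace V]
    (L : Euc n →L[ℝ] V) (X : Euc n) : L X = ∑ i, X i • L (stdVec i) := by
  conv_lhs => rw [← sum_smul_stdVec X, map_sum]
  simp only [map_smul]

lemma metricInner_pullbackMetric (F : Euc n → Euc N) (u X Y : Euc n) :
    metricInner (pullbackMetric F) u X Y = inner ℝ (fderiv ℝ F u X) (fderiv ℝ F u Y) := by
  rw [map_eq_sum_stdVec (fderiv ℝ F u) X, map_eq_sum_stdVec (fderiv ℝ F u) Y, sum_inner]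
  simp only [metricInner, pullbackMetric, Matrix.of_apply, inner_sum, real_inner_smul_left,
    real_inner_smul_right]
  exact Finset.sum_congr rfl fun i _ => Finset.sum_congr rfl fun j _ => by ring

lemma pderiv_pullbackMetric (hF : ContDiffAt ℝ 2 F u) (a i j : Fin n) :
    pderiv a (fun v => pullbackMetric F v i j) u =
      inner ℝ (fderiv ℝ F u (stdVec i)) (fderiv ℝ (fderiv ℝ F) u (stdVec a) (stdVec j)) +
      inner ℝ (fderiv ℝ (fderiv ℝ F) u (stdVec a) (stdVec i)) (fderiv ℝ F u (stdVec j)) := by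
  simp only [pderiv, pullbackMetric, Matrix.of_apply]
  rw [fderiv_inner_apply ℝ (differentiableAt_fderiv_apply hF _)
    (differentiableAt_fderiv_apply hF _), fderiv_fderiv_apply hF, fderiv_fderiv_apply hF]

lemma christoffel_pullbackMetric (hF : ContDiffAt ℝ 2 F u) (k i j : Fin n) :
    christoffel (pullbackMetric F) k i j u = ∑ l, (pullbackMetric F u)⁻¹ k l *
      inner ℝ (fderiv ℝ (fderiv ℝ F) u (stdVec i) (stdVec j)) (fderiv ℝ F u (stdVec l)) := by
  rw [christoffel, Finset.mul_sum]
  refine Finset.sum_congr rfl fun l _ => ?_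
  rw [pderiv_pullbackMetric hF, pderiv_pullbackMetric hF, pderiv_pullbackMetric hF,
    fderiv_fderiv_comm hF (stdVec j) (stdVec i), fderiv_fderiv_comm hF (stdVec l) (stdVec i),
    fderiv_fderiv_comm hF (stdVec l) (stdVec j),
    real_inner_comm (fderiv ℝ (fderiv ℝ F) u (stdVec i) (stdVec l)) (fderiv ℝ F u (stdVec j))]
  ring

lemma det_pullbackMetric_ne_zero (hinj : Function.Injective (fderiv ℝ F u)) :
    (pullbackMetric F u).det ≠ 0 := by
  intro hdet
  obtain ⟨x, hx, hgx⟩ := Matrix.exists_mulVec_eq_zero_iff.2 hdet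
  have hself : metricInner (pullbackMetric F) u (WithLp.toLp 2 x) (WithLp.toLp 2 x) = 0 := by
    calc metricInner (pullbackMetric F) u (WithLp.toLp 2 x) (WithLp.toLp 2 x)
        = ∑ i, x i * (pullbackMetric F u).mulVec x i := by
          simp only [metricInner, Matrix.mulVec, dotProduct, Finset.mul_sum]
          exact Finset.sum_congr rfl fun i _ => Finset.sum_congr rfl fun j _ => by ring
      _ = 0 := by simp [hgx]
  rw [metricInner_pullbackMetric, inner_self_eq_zero] at hself
  exact hx (congrArg WithLp.ofLp (hinj (hself.trans (map_zero _).symm)))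

lemma contDiffAt_pullbackMetric {r : WithTop ℕ∞} (hF : ContDiffAt ℝ (r + 1) F u) (i j : Fin n) :
    ContDiffAt ℝ r (fun v => pullbackMetric F v i j) u := by
  have h := hF.fderiv_right (m := r) le_rfl
  simp only [pullbackMetric, Matrix.of_apply]
  exact (h.clm_apply contDiffAt_const).inner ℝ (h.clm_apply contDiffAt_const)

lemma differentiableAt_christoffel (hF : ContDiffAt ℝ 3 F u) (hg : (pullbackMetric F u).det ≠ 0)
    (k i j : Fin n) : DifferentiableAt ℝ (christoffel (pullbackMetric F) k i j) u := by
  have hD1 := hF.fderiv_right (m := 1 + 1) (by norm_num)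
  have hD2 := hD1.fderiv_right (m := 1) le_rfl
  have heq : christoffel (pullbackMetric F) k i j =ᶠ[𝓝 u] fun v =>
      ∑ l, (pullbackMetric F v)⁻¹ k l *
        inner ℝ (fderiv ℝ (fderiv ℝ F) v (stdVec i) (stdVec j)) (fderiv ℝ F v (stdVec l)) := by
    filter_upwards [(hF.of_le (m := 2) (by norm_num)).eventually (by simp)] with v hv
    exact christoffel_pullbackMetric hv k i j
  refine DifferentiableAt.congr_of_eventuallyEq ?_ heq
  refine ContDiffAt.differentiableAt (n := 1) (ContDiffAt.sum fun l _ => ?_) one_ne_zero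
  exact (contDiffAt_matrix_inv (fun a b => contDiffAt_pullbackMetric (hF.of_le (by norm_num)) a b)
    hg k l).mul (((hD2.clm_apply contDiffAt_const).clm_apply contDiffAt_const).inner ℝ
      ((hD1.of_le (by norm_num)).clm_apply contDiffAt_const))

lemma sum_christoffel_mul (hF : ContDiffAt ℝ 2 F u) (hg : (pullbackMetric F u).det ≠ 0)
    (i j s : Fin n) :
    ∑ l, christoffel (pullbackMetric F) l i j u * pullbackMetric F u l s =
      inner ℝ (fderiv ℝ (fderiv ℝ F) u (stdVec i) (stdVec j)) (fderiv ℝ F u (stdVec s)) := by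
  set b : Fin n → ℝ := fun l =>
    inner ℝ (fderiv ℝ (fderiv ℝ F) u (stdVec i) (stdVec j)) (fderiv ℝ F u (stdVec l))
  have hΓ : (fun l => christoffel (pullbackMetric F) l i j u) =
      (pullbackMetric F u)⁻¹.mulVec b := funext fun l => christoffel_pullbackMetric hF l i j
  have hsymm : ∀ l, pullbackMetric F u l s = pullbackMetric F u s l := fun l => by
    simp only [pullbackMetric, Matrix.of_apply, real_inner_comm]
  calc ∑ l, christoffel (pullbackMetric F) l i j u * pullbackMetric F u l s
      = (pullbackMetric F u).mulVec (fun l => christoffel (pullbackMetric F) l i j u) s :=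
        Finset.sum_congr rfl fun l _ => by rw [hsymm, mul_comm]
    _ = b s := by
        rw [hΓ, Matrix.mulVec_mulVec, Matrix.mul_nonsing_inv _ (isUnit_iff_ne_zero.2 hg),
          Matrix.one_mulVec]

/-- The second fundamental form `II` at `u` of the immersion `F : ℝⁿ → ℝᴺ`, with values in the
normal space: the normal component of the second derivative of `F`. -/
noncomputable def secondFundamentalForm (F : Euc n → Euc N) (u : Euc n) :
    Euc n →L[ℝ] Euc n →L[ℝ] Euc N :=
  (ContinuousLinearMap.compL ℝ (Euc n) (Euc N) (Euc N)
    (LinearMap.range (fderiv ℝ F u).toLinearMap)ᗮ.starProjection).comp (fderiv ℝ (fderiv ℝ F) u)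

lemma secondFundamentalForm_apply (X Y : Euc n) : secondFundamentalForm F u X Y =
    (LinearMap.range (fderiv ℝ F u).toLinearMap)ᗮ.starProjection
      (fderiv ℝ (fderiv ℝ F) u X Y) := rfl

lemma secondFundamentalForm_eq {X Y : Euc n} {w : Euc N}
    (hw : ∀ V, inner ℝ w (fderiv ℝ F u V) = 0)
    (hsub : fderiv ℝ (fderiv ℝ F) u X Y - w ∈ LinearMap.range (fderiv ℝ F u).toLinearMap) :
    secondFundamentalForm F u X Y = w := by
  refine Submodule.eq_starProjection_of_mem_orthogonal ?_
    (by rwa [Submodule.orthogonal_orthogonal])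
  rw [Submodule.mem_orthogonal']
  rintro _ ⟨V, rfl⟩
  exact hw V

lemma inner_secondFundamentalForm (A B C D : Euc n) :
    inner ℝ (secondFundamentalForm F u A B) (secondFundamentalForm F u C D) =
      inner ℝ (secondFundamentalForm F u A B) (fderiv ℝ (fderiv ℝ F) u C D) := by
  rw [secondFundamentalForm_apply, secondFundamentalForm_apply,
    ← Submodule.inner_starProjection_left_eq_right,
    Submodule.starProjection_eq_self_iff.2 (Submodule.starProjection_apply_mem _ _)]

lemma secondFundamentalForm_comm (hF : ContDiffAt ℝ 2 F u) (X Y : Euc n) :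
    secondFundamentalForm F u X Y = secondFundamentalForm F u Y X := by
  rw [secondFundamentalForm_apply, fderiv_fderiv_comm hF, secondFundamentalForm_apply]

lemma secondFundamentalForm_stdVec (hF : ContDiffAt ℝ 2 F u)
    (hg : (pullbackMetric F u).det ≠ 0) (i j : Fin n) :
    secondFundamentalForm F u (stdVec i) (stdVec j) =
      fderiv ℝ (fderiv ℝ F) u (stdVec i) (stdVec j) -
        ∑ l, christoffel (pullbackMetric F) l i j u • fderiv ℝ F u (stdVec l) := by
  refine secondFundamentalForm_eq (fun V => ?_) ?_
  · rw [map_eq_sum_stdVec (fderiv ℝ F u) V, inner_sum]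
    refine Finset.sum_eq_zero fun s _ => ?_
    rw [real_inner_smul_right, inner_sub_left, sum_inner, ← sum_christoffel_mul hF hg]
    simp [real_inner_smul_left, pullbackMetric]
  · rw [sub_sub_cancel]
    exact Submodule.sum_mem _ fun l _ => Submodule.smul_mem _ _ ⟨_, rfl⟩

lemma fderiv_inner_fderiv_fderiv (hF : ContDiffAt ℝ 3 F u) (i j k s : Fin n) :
    fderiv ℝ (fun v => inner ℝ (fderiv ℝ (fderiv ℝ F) v (stdVec j) (stdVec k))
        (fderiv ℝ F v (stdVec s))) u (stdVec i) =
      inner ℝ (fderiv ℝ (fderiv ℝ F) u (stdVec j) (stdVec k))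
        (fderiv ℝ (fderiv ℝ F) u (stdVec i) (stdVec s)) +
      inner ℝ (fderiv ℝ (fderiv ℝ (fderiv ℝ F)) u (stdVec i) (stdVec j) (stdVec k))
        (fderiv ℝ F u (stdVec s)) := by
  have hF2 : ContDiffAt ℝ 2 F u := hF.of_le (by norm_num)
  have hD2 : DifferentiableAt ℝ (fderiv ℝ (fderiv ℝ F)) u :=
    ((hF.fderiv_right (m := 2) (by norm_num)).fderiv_right (m := 1)
      (by norm_num)).differentiableAt one_ne_zero
  have hD2j := hD2.clm_apply (differentiableAt_const (stdVec j))
  rw [fderiv_inner_apply ℝ (hD2j.clm_apply (differentiableAt_const _))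
    (differentiableAt_fderiv_apply hF2 _), fderiv_fderiv_apply hF2,
    fderiv_clm_apply hD2j (differentiableAt_const _),
    fderiv_clm_apply hD2 (differentiableAt_const _)]
  simp

/-- `∇ᵢ∇ⱼ∂ₖ` and the third derivative of `F` differ by a shape operator term. -/
lemma sum_pderiv_christoffel_mul (hF : ContDiffAt ℝ 3 F u)
    (hg : (pullbackMetric F u).det ≠ 0) (i j k s : Fin n) :
    ∑ l, (pderiv i (christoffel (pullbackMetric F) l j k) u +
        ∑ a, christoffel (pullbackMetric F) l i a u * christoffel (pullbackMetric F) a j k u) *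
          pullbackMetric F u l s =
      inner ℝ (fderiv ℝ (fderiv ℝ (fderiv ℝ F)) u (stdVec i) (stdVec j) (stdVec k))
        (fderiv ℝ F u (stdVec s)) +
      inner ℝ (secondFundamentalForm F u (stdVec j) (stdVec k))
        (fderiv ℝ (fderiv ℝ F) u (stdVec i) (stdVec s)) := by
  have hF2 : ContDiffAt ℝ 2 F u := hF.of_le (by norm_num)
  have hgd : ∀ a b, ContDiffAt ℝ 1 (fun v => pullbackMetric F v a b) u :=
    contDiffAt_pullbackMetric (hF.of_le (by norm_num))
  have hquad : ∑ l, (∑ a, christoffel (pullbackMetric F) l i a u *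
      christoffel (pullbackMetric F) a j k u) * pullbackMetric F u l s =
      ∑ a, christoffel (pullbackMetric F) a j k u *
        inner ℝ (fderiv ℝ (fderiv ℝ F) u (stdVec i) (stdVec a)) (fderiv ℝ F u (stdVec s)) := by
    simp only [← sum_christoffel_mul hF2 hg, Finset.mul_sum, Finset.sum_mul]
    rw [Finset.sum_comm]
    exact Finset.sum_congr rfl fun a _ => Finset.sum_congr rfl fun l _ => by ring
  have heq : (fun v => ∑ l, christoffel (pullbackMetric F) l j k v * pullbackMetric F v l s)
      =ᶠ[𝓝 u] fun v => inner ℝ (fderiv ℝ (fderiv ℝ F) v (stdVec j) (stdVec k))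
        (fderiv ℝ F v (stdVec s)) := by
    filter_upwards [hF2.eventually (by simp),
      (contDiffAt_matrix_det hgd).continuousAt.eventually_ne hg] with v hv hgv
    exact sum_christoffel_mul hv hgv j k s
  have hderiv : ∑ l, (christoffel (pullbackMetric F) l j k u *
        pderiv i (fun v => pullbackMetric F v l s) u +
      pullbackMetric F u l s * pderiv i (christoffel (pullbackMetric F) l j k) u) =
      fderiv ℝ (fun v => inner ℝ (fderiv ℝ (fderiv ℝ F) v (stdVec j) (stdVec k))
        (fderiv ℝ F v (stdVec s))) u (stdVec i) := by
    have hΓ := fun l => differentiableAt_christoffel hF hg l j k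
    have hgd' := fun l => (hgd l s).differentiableAt one_ne_zero
    rw [← heq.fderiv_eq, fderiv_fun_sum fun l _ => (hΓ l).fun_mul (hgd' l), sum_apply]
    exact Finset.sum_congr rfl fun l _ => by rw [fderiv_fun_mul (hΓ l) (hgd' l)]; rfl
  rw [fderiv_inner_fderiv_fderiv hF] at hderiv
  simp only [pderiv_pullbackMetric hF2, mul_add, Finset.sum_add_distrib] at hderiv
  simp only [add_mul, Finset.sum_add_distrib, hquad, secondFundamentalForm_stdVec hF2 hg,
    inner_sub_left, sum_inner, real_inner_smul_left, mul_comm (pderiv i _ u)]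
  linarith

lemma sum_riemann_mul (hF : ContDiffAt ℝ 3 F u) (hg : (pullbackMetric F u).det ≠ 0)
    (k i j s : Fin n) :
    ∑ l, riemann (pullbackMetric F) l k i j u * pullbackMetric F u l s =
      inner ℝ (secondFundamentalForm F u (stdVec j) (stdVec k))
        (secondFundamentalForm F u (stdVec i) (stdVec s)) -
      inner ℝ (secondFundamentalForm F u (stdVec i) (stdVec k))
        (secondFundamentalForm F u (stdVec j) (stdVec s)) := by
  have hsymm : fderiv ℝ (fderiv ℝ (fderiv ℝ F)) u (stdVec i) (stdVec j) (stdVec k) =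
      fderiv ℝ (fderiv ℝ (fderiv ℝ F)) u (stdVec j) (stdVec i) (stdVec k) := by
    rw [(hF.fderiv_right (m := 2) (by norm_num)).isSymmSndFDerivAt (by simp) (stdVec i)]
  have hij := sum_pderiv_christoffel_mul hF hg i j k s
  have hji := sum_pderiv_christoffel_mul hF hg j i k s
  simp only [add_mul, Finset.sum_add_distrib] at hij hji
  simp only [inner_secondFundamentalForm, riemann, Finset.sum_sub_distrib, add_mul, sub_mul,
    Finset.sum_add_distrib]
  rw [hsymm] at hij
  linarith

lemma inner_apply_apply_eq_sum (B : Euc n →L[ℝ] Euc n →L[ℝ] Euc N) (V W X Y : Euc n) :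
    inner ℝ (B V W) (B X Y) = ∑ i, ∑ j, ∑ k, ∑ s,
      inner ℝ (B (stdVec j) (stdVec k)) (B (stdVec i) (stdVec s)) * (X i * V j * W k * Y s) := by
  have hB : ∀ V W, B V W = ∑ i, ∑ j, (V i * W j) • B (stdVec i) (stdVec j) := fun V W => by
    rw [map_eq_sum_stdVec B V, sum_apply]
    refine Finset.sum_congr rfl fun i _ => ?_
    rw [smul_apply, map_eq_sum_stdVec _ W, Finset.smul_sum]
    simp only [smul_smul]
  rw [hB X Y, inner_sum]
  refine Finset.sum_congr rfl fun i _ => ?_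
  rw [hB V W, sum_inner]
  refine Finset.sum_congr rfl fun j _ => ?_
  rw [sum_inner]
  simp only [inner_sum, real_inner_smul_left, real_inner_smul_right]
  exact Finset.sum_congr rfl fun k _ => Finset.sum_congr rfl fun s _ => by ring

/-- The **Gauss equation**. -/
theorem sectionalCurvature_pullbackMetric (hF : ContDiffAt ℝ 3 F u)
    (hinj : Function.Injective (fderiv ℝ F u)) (X Y : Euc n) :
    sectionalCurvature (pullbackMetric F) u X Y =
      (inner ℝ (secondFundamentalForm F u X X) (secondFundamentalForm F u Y Y) -
        inner ℝ (secondFundamentalForm F u X Y) (secondFundamentalForm F u X Y)) /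
      gramDet (fderiv ℝ F u X) (fderiv ℝ F u Y) := by
  have hg := det_pullbackMetric_ne_zero hinj
  have hsum : ∀ i j k, ∑ l, ∑ s, pullbackMetric F u l s * riemann (pullbackMetric F) l k i j u *
      X i * Y j * Y k * X s = ∑ s,
        (inner ℝ (secondFundamentalForm F u (stdVec j) (stdVec k))
          (secondFundamentalForm F u (stdVec i) (stdVec s)) -
        inner ℝ (secondFundamentalForm F u (stdVec i) (stdVec k))
          (secondFundamentalForm F u (stdVec j) (stdVec s))) * (X i * Y j * Y k * X s) := by
    intro i j k
    rw [Finset.sum_comm]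
    refine Finset.sum_congr rfl fun s _ => ?_
    rw [← sum_riemann_mul hF hg, Finset.sum_mul]
    exact Finset.sum_congr rfl fun l _ => by ring
  have hXY : inner ℝ (secondFundamentalForm F u X Y) (secondFundamentalForm F u X Y) =
      ∑ i, ∑ j, ∑ k, ∑ s, inner ℝ (secondFundamentalForm F u (stdVec i) (stdVec k))
        (secondFundamentalForm F u (stdVec j) (stdVec s)) * (X i * Y j * Y k * X s) := by
    nth_rewrite 2 [secondFundamentalForm_comm (hF.of_le (by norm_num)) X Y]
    rw [inner_apply_apply_eq_sum, Finset.sum_comm]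
    simp only [mul_comm (Y _) (X _)]
  simp only [sectionalCurvature, gramDet, metricInner_pullbackMetric, hsum, sub_mul,
    Finset.sum_sub_distrib, ← hXY, ← inner_apply_apply_eq_sum]
  rw [real_inner_comm]

lemma sectionalCurvature_pullbackMetric_of_normal (hF : ContDiffAt ℝ 3 F u)
    (hinj : Function.Injective (fderiv ℝ F u)) {v : Euc N} (hv : v ≠ 0)
    (hperp : ∀ V, inner ℝ v (fderiv ℝ F u V) = 0)
    (htan : ∀ X Y, fderiv ℝ (fderiv ℝ F) u X Y - (secondForm F u v X Y / inner ℝ v v) • v ∈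
      LinearMap.range (fderiv ℝ F u).toLinearMap) (X Y : Euc n) :
    sectionalCurvature (pullbackMetric F) u X Y =
      (secondForm F u v X X * secondForm F u v Y Y - secondForm F u v X Y ^ 2) / inner ℝ v v /
      gramDet (fderiv ℝ F u X) (fderiv ℝ F u Y) := by
  have hII : ∀ X Y, secondFundamentalForm F u X Y =
      (secondForm F u v X Y / inner ℝ v v) • v := fun X Y =>
    secondFundamentalForm_eq (fun V => by rw [real_inner_smul_left, hperp, mul_zero]) (htan X Y)
  have hvv : inner ℝ v v ≠ 0 := inner_self_ne_zero.2 hv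
  rw [sectionalCurvature_pullbackMetric hF hinj]
  simp only [hII, real_inner_smul_left, real_inner_smul_right]
  congr 1
  field_simp

lemma sectionalCurvature_congr {g g' : Euc n → Matrix (Fin n) (Fin n) ℝ}
    (h : g =ᶠ[𝓝 u] g') (X Y : Euc n) :
    sectionalCurvature g u X Y = sectionalCurvature g' u X Y := by
  have hp : ∀ v, g =ᶠ[𝓝 v] g' → ∀ a i j, pderiv a (fun v => g v i j) v =
      pderiv a (fun v => g' v i j) v := fun v hv a i j => by
    have hij : (fun v => g v i j) =ᶠ[𝓝 v] fun v => g' v i j :=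
      hv.mono fun x hx => congrFun (congrFun hx i) j
    rw [pderiv, hij.fderiv_eq, pderiv]
  have hc : ∀ k i j, christoffel g k i j =ᶠ[𝓝 u] christoffel g' k i j := fun k i j => by
    filter_upwards [h.eventuallyEq_nhds] with v hv
    simp only [christoffel, hp v hv, hv.eq_of_nhds]
  simp only [sectionalCurvature, metricInner, riemann, pderiv, (hc _ _ _).fderiv_eq,
    (hc _ _ _).eq_of_nhds, h.eq_of_nhds]

lemma pullbackMetric_congr {F G : Euc n → Euc N} (h : F =ᶠ[𝓝 u] G) :
    pullbackMetric F =ᶠ[𝓝 u] pullbackMetric G := by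
  filter_upwards [h.eventuallyEq_nhds] with v hv
  simp only [pullbackMetric, hv.fderiv_eq]

end Gauss

section LinearAlgebra

lemma linearIndependent_pair_of_map {V W : Type*} [AddCommGroup V] [Module ℝ V] [AddCommGroup W]
    [Module ℝ W] {L : V →ₗ[ℝ] W} {x y : V} (hx : x ≠ 0) (hLx : L x = 0) (hLy : L y ≠ 0) :
    LinearIndependent ℝ ![x, y] := by
  refine LinearIndependent.pair_iff.2 fun s t hst => ?_
  have ht : t = 0 := by simpa [hLx, hLy] using congrArg L hst
  exact ⟨by simpa [ht, hx] using hst, ht⟩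

variable {E G : Type*} [AddCommGroup E] [Module ℝ E] [NormedAddCommGroup G]
  [InnerProductSpace ℝ G] [FiniteDimensional ℝ G]

lemma mem_range_of_inner_eq_zero {A : E →ₗ[ℝ] G} (hA : Function.Injective A) {ι : Type*}
    [Fintype ι] {w : ι → G} (hw : LinearIndependent ℝ w)
    (hdim : Module.finrank ℝ E + Fintype.card ι = Module.finrank ℝ G)
    (hperp : ∀ i x, inner ℝ (w i) (A x) = 0) {v : G} (hv : ∀ i, inner ℝ (w i) v = 0) :
    v ∈ LinearMap.range A := by
  have hle : Submodule.span ℝ (Set.range w) ≤ (LinearMap.range A)ᗮ := by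
    rw [Submodule.span_le]
    rintro _ ⟨i, rfl⟩
    rw [SetLike.mem_coe, Submodule.mem_orthogonal']
    rintro _ ⟨x, rfl⟩
    exact hperp i x
  have hspan : Submodule.span ℝ (Set.range w) = (LinearMap.range A)ᗮ := by
    refine Submodule.eq_of_le_of_finrank_eq hle ?_
    have hsum := Submodule.finrank_add_finrank_orthogonal (LinearMap.range A)
    rw [LinearMap.finrank_range_of_inj hA] at hsum
    rw [finrank_span_eq_card hw]
    omega
  have hvperp : Submodule.span ℝ (Set.range w) ≤ (ℝ ∙ v)ᗮ := by
    rw [Submodule.span_le]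
    rintro _ ⟨i, rfl⟩
    exact Submodule.mem_orthogonal_singleton_iff_inner_left.2 (hv i)
  rw [← Submodule.orthogonal_orthogonal (LinearMap.range A), ← hspan, Submodule.mem_orthogonal]
  exact fun x hx => Submodule.mem_orthogonal_singleton_iff_inner_left.1 (hvperp hx)

end LinearAlgebra

section Limit

lemma eq_zero_and_le_of_mul_ge {q r Q : ℝ → ℝ} {q' r' Q₀ δ : ℝ} (hq : HasDerivAt q q' 0)
    (hr : HasDerivAt r r' 0) (hr0 : r 0 = 0) (hr' : r' ≠ 0) (hδ : 0 ≤ δ)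
    (hQ : Tendsto (fun t => Q t / t ^ 2) (𝓝[≠] 0) (𝓝 Q₀))
    (hQ0 : ∀ᶠ t in 𝓝[≠] 0, 0 ≤ Q t) (h : ∀ᶠ t in 𝓝[≠] 0, δ * Q t ≤ q t * r t) :
    q 0 = 0 ∧ δ * Q₀ ≤ q' * r' := by
  have hslope : ∀ {p : ℝ → ℝ} {p' : ℝ}, HasDerivAt p p' 0 → p 0 = 0 →
      Tendsto (fun t => p t / t) (𝓝[≠] 0) (𝓝 p') := fun hp hp0 => by
    simpa only [div_eq_inv_mul, smul_eq_mul] using tendsto_inv_smul_of_hasDerivAt hp hp0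
  have hqr : Tendsto (fun t => q t * r t / t) (𝓝[≠] 0) (𝓝 (q 0 * r')) := by
    simpa only [mul_div_assoc] using
      (hq.continuousAt.tendsto.mono_left nhdsWithin_le_nhds).mul (hslope hr hr0)
  have hqr0 : ∀ᶠ t in 𝓝[≠] 0, 0 ≤ q t * r t := by
    filter_upwards [h, hQ0] with t ht hQt using (mul_nonneg hδ hQt).trans ht
  have hnonneg : 0 ≤ q 0 * r' := by
    refine ge_of_tendsto (hqr.mono_left (nhdsGT_le_nhdsNE 0)) ?_
    filter_upwards [nhdsGT_le_nhdsNE 0 hqr0, self_mem_nhdsWithin] with t ht (ht0 : 0 < t)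
      using div_nonneg ht ht0.le
  have hnonpos : q 0 * r' ≤ 0 := by
    refine le_of_tendsto (hqr.mono_left (nhdsLT_le_nhdsNE 0)) ?_
    filter_upwards [nhdsLT_le_nhdsNE 0 hqr0, self_mem_nhdsWithin] with t ht (ht0 : t < 0)
      using div_nonpos_of_nonneg_of_nonpos ht ht0.le
  have hq0 : q 0 = 0 := (mul_eq_zero.1 (le_antisymm hnonpos hnonneg)).resolve_right hr'
  refine ⟨hq0, le_of_tendsto_of_tendsto (hQ.const_mul δ) ((hslope hq hq0).mul (hslope hr hr0)) ?_⟩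
  filter_upwards [h] with t ht
  rw [← mul_div_assoc, div_mul_div_comm, ← pow_two]
  exact div_le_div_of_nonneg_right ht (sq_nonneg t)

end Limit

section Line

variable {E G : Type*} [NormedAddCommGroup E] [NormedSpace ℝ E] [NormedAddCommGroup G]
  [NormedSpace ℝ G] {g : E → G} {u : E}

lemma hasDerivAt_line (u v : E) : HasDerivAt (fun t : ℝ => u + t • v) v 0 := by
  simpa using ((hasDerivAt_id (0 : ℝ)).smul_const v).const_add u

lemma tendsto_line (u v : E) : Tendsto (fun t : ℝ => u + t • v) (𝓝 0) (𝓝 u) := by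
  simpa using (hasDerivAt_line u v).continuousAt.tendsto

lemma hasDerivAt_fderiv_line (hg : ContDiffAt ℝ 2 g u) {Z : ℝ → E} {Z' : E}
    (hZ : HasDerivAt Z Z' 0) (v : E) :
    HasDerivAt (fun t : ℝ => fderiv ℝ g (u + t • v) (Z t))
      (fderiv ℝ (fderiv ℝ g) u v (Z 0) + fderiv ℝ g u Z') 0 := by
  have hD : HasFDerivAt (fderiv ℝ g) (fderiv ℝ (fderiv ℝ g) u) (u + (0 : ℝ) • v) := by
    simpa using (differentiableAt_fderiv hg).hasFDerivAt
  have hDt : HasDerivAt (fun t : ℝ => fderiv ℝ g (u + t • v)) (fderiv ℝ (fderiv ℝ g) u v) 0 :=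
    HasFDerivAt.comp_hasDerivAt (f := fun t : ℝ => u + t • v) 0 hD (hasDerivAt_line u v)
  simpa only [zero_smul, add_zero] using HasDerivAt.clm_apply hDt hZ

end Line

section Normal

variable {E G : Type*} [NormedAddCommGroup E] [NormedSpace ℝ E] [NormedAddCommGroup G]
  [InnerProductSpace ℝ G] {g ν : E → G} {u η : E}

/-- Near `u`, the field `ν` is a unit normal field along `g`; the regularity required at `u` is the
one needed for the Gauss equation of `g` and for the second derivatives of `ν`. -/
structure IsUnitNormalAt (g ν : E → G) (u : E) : Prop where
  contDiffAt : ContDiffAt ℝ 3 g u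
  contDiffAt_normal : ContDiffAt ℝ 2 ν u
  unit : ∀ᶠ v in 𝓝 u, ‖ν v‖ = 1
  normal : ∀ᶠ v in 𝓝 u, ∀ X, inner ℝ (fderiv ℝ g v X) (ν v) = 0

namespace IsUnitNormalAt

lemma eventually (h : IsUnitNormalAt g ν u) : ∀ᶠ v in 𝓝 u, IsUnitNormalAt g ν v := by
  filter_upwards [h.contDiffAt.eventually (by simp), h.contDiffAt_normal.eventually (by simp),
    h.unit.eventually_nhds, h.normal.eventually_nhds] with v h1 h2 h3 h4 using ⟨h1, h2, h3, h4⟩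

lemma contDiffAt_two (h : IsUnitNormalAt g ν u) : ContDiffAt ℝ 2 g u :=
  h.contDiffAt.of_le (by norm_num)

lemma differentiableAt_normal (h : IsUnitNormalAt g ν u) : DifferentiableAt ℝ ν u :=
  h.contDiffAt_normal.differentiableAt two_ne_zero

lemma normal_ne_zero (h : IsUnitNormalAt g ν u) : ν u ≠ 0 :=
  norm_ne_zero_iff.1 (h.unit.self_of_nhds ▸ one_ne_zero)

lemma inner_normal_fderiv_left (h : IsUnitNormalAt g ν u) (V : E) :
    inner ℝ (ν u) (fderiv ℝ g u V) = 0 := by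
  rw [real_inner_comm, h.normal.self_of_nhds]

lemma secondForm_normal (h : IsUnitNormalAt g ν u) (U V : E) :
    secondForm g u (ν u) U V = -inner ℝ (fderiv ℝ g u V) (fderiv ℝ ν u U) := by
  have hzero : (fun v => inner ℝ (fderiv ℝ g v V) (ν v)) =ᶠ[𝓝 u] fun _ => (0 : ℝ) :=
    h.normal.mono fun v hv => hv V
  have hderiv := congrArg (fun L : E →L[ℝ] ℝ => L U) hzero.fderiv_eq
  rw [fderiv_inner_apply ℝ (differentiableAt_fderiv_apply h.contDiffAt_two V)
    h.differentiableAt_normal, fderiv_fderiv_apply h.contDiffAt_two, fderiv_const_apply] at hderiv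
  rw [secondForm_apply]
  exact (neg_eq_of_add_eq_zero_right hderiv).symm

lemma inner_fderiv_comm (h : IsUnitNormalAt g ν u) (U V : E) :
    inner ℝ (fderiv ℝ g u V) (fderiv ℝ ν u U) = inner ℝ (fderiv ℝ g u U) (fderiv ℝ ν u V) := by
  rw [← neg_inj, ← h.secondForm_normal, ← h.secondForm_normal]
  exact (isSymm_secondForm h.contDiffAt_two (ν u)).eq U V

lemma inner_normal_fderiv (h : IsUnitNormalAt g ν u) (U : E) :
    inner ℝ (ν u) (fderiv ℝ ν u U) = 0 := by
  have hone : (fun v => inner ℝ (ν v) (ν v)) =ᶠ[𝓝 u] fun _ => (1 : ℝ) :=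
    h.unit.mono fun v hv => (real_inner_self_eq_norm_sq _).trans (by rw [hv, one_pow])
  have hderiv := congrArg (fun L : E →L[ℝ] ℝ => L U) hone.fderiv_eq
  rw [fderiv_inner_apply ℝ h.differentiableAt_normal h.differentiableAt_normal,
    real_inner_comm (ν u) (fderiv ℝ ν u U), fderiv_const_apply, zero_apply] at hderiv
  linarith

lemma inner_fderiv_null (h : IsUnitNormalAt g ν u) (hη : fderiv ℝ g u η = 0) (V : E) :
    inner ℝ (fderiv ℝ g u V) (fderiv ℝ ν u η) = 0 := by
  rw [h.inner_fderiv_comm, hη, inner_zero_left]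

lemma hasDerivAt_secondForm_line (h : IsUnitNormalAt g ν u) {X : ℝ → E} {X' : E}
    (hX : HasDerivAt X X' 0) (v : E) :
    HasDerivAt (fun t => secondForm g (u + t • v) (ν (u + t • v)) (X t) (X t))
      (-(inner ℝ (fderiv ℝ g u (X 0)) (fderiv ℝ (fderiv ℝ ν) u v (X 0) + fderiv ℝ ν u X') +
        inner ℝ (fderiv ℝ (fderiv ℝ g) u v (X 0) + fderiv ℝ g u X') (fderiv ℝ ν u (X 0)))) 0 := by
  have hinner := ((hasDerivAt_fderiv_line h.contDiffAt_two hX v).inner ℝ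
    (hasDerivAt_fderiv_line h.contDiffAt_normal hX v)).neg
  simp only [zero_smul, add_zero] at hinner
  refine hinner.congr_of_eventuallyEq ?_
  filter_upwards [(tendsto_line u v).eventually h.eventually] with t ht
  exact ht.secondForm_normal _ _

/-- Differentiate the identity `⟨dg X, dν η⟩ = ⟨dg η, dν X⟩` along `X`. -/
lemma secondForm_fderiv_null (h : IsUnitNormalAt g ν u) (hη : fderiv ℝ g u η = 0) {X X' : E}
    (hX' : fderiv ℝ (fderiv ℝ g) u η X + fderiv ℝ g u X' = 0) :
    secondForm g u (fderiv ℝ ν u η) X X =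
      -inner ℝ (fderiv ℝ g u X) (fderiv ℝ (fderiv ℝ ν) u η X + fderiv ℝ ν u X') := by
  have hg := h.contDiffAt_two
  have hν := h.contDiffAt_normal
  have hcomm : (fun v => inner ℝ (fderiv ℝ g v X) (fderiv ℝ ν v η)) =ᶠ[𝓝 u]
      fun v => inner ℝ (fderiv ℝ g v η) (fderiv ℝ ν v X) :=
    h.eventually.mono fun v hv => hv.inner_fderiv_comm η X
  have hderiv := congrArg (fun L : E →L[ℝ] ℝ => L X) hcomm.fderiv_eq
  rw [fderiv_inner_apply ℝ (differentiableAt_fderiv_apply hg X)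
      (differentiableAt_fderiv_apply hν η),
    fderiv_inner_apply ℝ (differentiableAt_fderiv_apply hg η) (differentiableAt_fderiv_apply hν X),
    fderiv_fderiv_apply hg, fderiv_fderiv_apply hν, fderiv_fderiv_apply hg,
    fderiv_fderiv_comm hν X η, fderiv_fderiv_comm hg X η, hη, inner_zero_left, zero_add,
    eq_neg_of_add_eq_zero_left hX', inner_neg_left, h.inner_fderiv_comm] at hderiv
  rw [secondForm_apply, inner_add_right]
  linarith

lemma hasDerivAt_secondForm_line_of_add_eq_zero (h : IsUnitNormalAt g ν u)
    (hη : fderiv ℝ g u η = 0) {X X' : E}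
    (hX' : fderiv ℝ (fderiv ℝ g) u η X + fderiv ℝ g u X' = 0) :
    HasDerivAt (fun t : ℝ => secondForm g (u + t • η) (ν (u + t • η)) (X + t • X') (X + t • X'))
      (secondForm g u (fderiv ℝ ν u η) X X) 0 := by
  convert h.hasDerivAt_secondForm_line (hasDerivAt_line X X') η using 1
  rw [h.secondForm_fderiv_null hη hX', zero_smul, add_zero, hX', inner_zero_left, add_zero]

lemma hasDerivAt_secondForm_line_null (h : IsUnitNormalAt g ν u) (hη : fderiv ℝ g u η = 0)
    {Z : ℝ → E} {Z' : E} (hZ : HasDerivAt Z Z' 0) (hZ0 : Z 0 = η) :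
    HasDerivAt (fun t => secondForm g (u + t • η) (ν (u + t • η)) (Z t) (Z t))
      (-secondForm g u (fderiv ℝ ν u η) η η) 0 := by
  convert h.hasDerivAt_secondForm_line hZ η using 1
  rw [hZ0, hη, inner_zero_left, zero_add, inner_add_left, h.inner_fderiv_null hη, add_zero,
    secondForm_apply]

end IsUnitNormalAt

end Normal

section Curvature

variable {n : ℕ} {g ν : Euc n → Euc (n + 1)} {u η : Euc n} {δ : ℝ}

lemma IsUnitNormalAt.sectionalCurvature_eq (h : IsUnitNormalAt g ν u)
    (hinj : Function.Injective (fderiv ℝ g u)) (X Y : Euc n) :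
    sectionalCurvature (pullbackMetric g) u X Y =
      (secondForm g u (ν u) X X * secondForm g u (ν u) Y Y - secondForm g u (ν u) X Y ^ 2) /
        gramDet (fderiv ℝ g u X) (fderiv ℝ g u Y) := by
  have hunit : inner ℝ (ν u) (ν u) = (1 : ℝ) := by
    rw [real_inner_self_eq_norm_sq, h.unit.self_of_nhds, one_pow]
  rw [sectionalCurvature_pullbackMetric_of_normal h.contDiffAt hinj h.normal_ne_zero
    h.inner_normal_fderiv_left, hunit, div_one]
  intro X Y
  refine mem_range_of_inner_eq_zero (w := ![ν u]) hinj
    (linearIndependent_unique_iff.2 h.normal_ne_zero) (by simp) (fun i V => ?_) fun i => ?_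
  · simpa using h.inner_normal_fderiv_left V
  · simp only [Matrix.cons_val_fin_one]
    rw [inner_sub_right, inner_smul_right, hunit, div_one, mul_one, secondForm_apply,
      real_inner_comm, sub_self]

lemma IsUnitNormalAt.mul_gramDet_le (h : IsUnitNormalAt g ν u)
    (hinj : Function.Injective (fderiv ℝ g u)) {X Y : Euc n} (hXY : LinearIndependent ℝ ![X, Y])
    (hK : δ ≤ sectionalCurvature (pullbackMetric g) u X Y) :
    0 ≤ gramDet (fderiv ℝ g u X) (fderiv ℝ g u Y) ∧
    δ * gramDet (fderiv ℝ g u X) (fderiv ℝ g u Y) ≤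
      secondForm g u (ν u) X X * secondForm g u (ν u) Y Y := by
  have hgram : 0 < gramDet (fderiv ℝ g u X) (fderiv ℝ g u Y) :=
    gramDet_map_pos (L := (fderiv ℝ g u).toLinearMap) hinj hXY
  rw [h.sectionalCurvature_eq hinj, le_div_iff₀ hgram] at hK
  exact ⟨hgram.le, hK.trans (sub_le_self _ (sq_nonneg _))⟩

/-- The limit of the Gauss equation along the null line `t ↦ u + t η`. As `X'` makes `dg X(t)`
constant to first order for `X(t) = X + t X'`, the derivatives at `0` of `II(X(t), X(t))` and
`II(Z(t), Z(t))`, where `II` is the second fundamental form with respect to `ν`, only involve the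
component of the second derivative of `g` along `dν η`. -/
theorem IsUnitNormalAt.secondForm_eq_zero_and_le_of_curvature_ge (h : IsUnitNormalAt g ν u)
    (hη : fderiv ℝ g u η = 0) (ha : secondForm g u (fderiv ℝ ν u η) η η ≠ 0)
    (hreg : ∀ᶠ t : ℝ in 𝓝[≠] 0, Function.Injective (fderiv ℝ g (u + t • η)))
    {X X' : Euc n} (hX : fderiv ℝ g u X ≠ 0)
    (hX' : fderiv ℝ (fderiv ℝ g) u η X + fderiv ℝ g u X' = 0) {Z : ℝ → Euc n}
    (hZ : DifferentiableAt ℝ Z 0) (hZ0 : Z 0 = η) (hδ : 0 ≤ δ)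
    (hK : ∀ᶠ t : ℝ in 𝓝[≠] 0, ∀ Y, LinearIndependent ℝ ![Y, Z t] →
      δ ≤ sectionalCurvature (pullbackMetric g) (u + t • η) Y (Z t)) :
    secondForm g u (ν u) X X = 0 ∧ ∃ Q : ℝ, 0 < Q ∧ δ * Q ≤
      -(secondForm g u (fderiv ℝ ν u η) X X * secondForm g u (fderiv ℝ ν u η) η η) := by
  have hη0 : η ≠ 0 := by rintro rfl; simp at ha
  have hg := h.contDiffAt_two
  have hdgX := hasDerivAt_fderiv_line hg (hasDerivAt_line X X') η
  have hdgZ := hasDerivAt_fderiv_line hg hZ.hasDerivAt η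
  have hq := h.hasDerivAt_secondForm_line_of_add_eq_zero hη hX'
  have hr := h.hasDerivAt_secondForm_line_null hη hZ.hasDerivAt hZ0
  have hr0 : secondForm g (u + (0 : ℝ) • η) (ν (u + (0 : ℝ) • η)) (Z 0) (Z 0) = 0 := by
    rw [zero_smul, add_zero, hZ0, h.secondForm_normal, hη, inner_zero_left, neg_zero]
  have hQ := tendsto_gramDet_div_sq hdgX.continuousAt hdgZ
    (by rw [zero_smul, add_zero, hZ0, hη])
  have hQ₀ : 0 < gramDet (fderiv ℝ g u X)
      (fderiv ℝ (fderiv ℝ g) u η η + fderiv ℝ g u (deriv Z 0)) := by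
    refine gramDet_pos (linearIndependent_pair_of_map (L := innerₗ _ (fderiv ℝ ν u η)) hX ?_ ?_)
    · rw [innerₗ_apply_apply, real_inner_comm, h.inner_fderiv_null hη]
    · rwa [innerₗ_apply_apply, real_inner_comm, inner_add_left, h.inner_fderiv_null hη, add_zero]
  have hli : ∀ᶠ t : ℝ in 𝓝 0, LinearIndependent ℝ ![X + t • X', Z t] := by
    have hli0 : LinearIndependent ℝ ![X, η] := LinearIndependent.pair_symm_iff.1
      (linearIndependent_pair_of_map (L := (fderiv ℝ g u).toLinearMap) hη0 hη hX)
    have htend : Tendsto (fun t : ℝ => ![X + t • X', Z t]) (𝓝 0) (𝓝 ![X, η]) :=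
      tendsto_pi_nhds.2 (Fin.forall_fin_two.2
        ⟨tendsto_line X X', by simpa [hZ0] using hZ.continuousAt.tendsto⟩)
    exact htend.eventually hli0.eventually
  have hle := (((hreg.and hK).and (hli.filter_mono nhdsWithin_le_nhds)).and
    (((tendsto_line u η).eventually h.eventually).filter_mono nhdsWithin_le_nhds)).mono
    fun t ⟨⟨⟨hinj, hKt⟩, hlit⟩, ht⟩ => ht.mul_gramDet_le hinj hlit (hKt _ hlit)
  obtain ⟨hq0, hbound⟩ := eq_zero_and_le_of_mul_ge hq hr hr0 (neg_ne_zero.2 ha) hδ hQ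
    (hle.mono fun _ ht => ht.1) (hle.mono fun _ ht => ht.2)
  simp only [zero_smul, add_zero, hZ0] at hq0 hbound
  exact ⟨hq0, _, hQ₀, by rwa [mul_neg] at hbound⟩

end Curvature

section BilinForm

variable {V : Type*} [AddCommGroup V] [Module ℝ V] {B : LinearMap.BilinForm ℝ V} {a : ℝ}

lemma bilinForm_sq_le (hB : LinearMap.IsSymm B) (ha : a ≠ 0) (h : ∀ x, 0 ≤ a * B x x) (x y : V) :
    B x y ^ 2 ≤ B x x * B y y := by
  have hle := LinearMap.BilinForm.apply_sq_le_of_symm (a • B) (fun x => by simpa using h x)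
    ⟨fun x y => congrArg (a * ·) (hB.eq x y)⟩ x y
  simp only [LinearMap.smul_apply, smul_eq_mul] at hle
  nlinarith [sq_pos_of_ne_zero ha]

lemma bilinForm_sq_lt (hB : LinearMap.IsSymm B) (h : ∀ x ≠ 0, 0 < a * B x x) {x y : V}
    (hxy : LinearIndependent ℝ ![x, y]) : B x y ^ 2 < B x x * B y y := by
  have hlt := (LinearMap.BilinForm.apply_sq_lt_iff_linearIndependent_of_symm (a • B)
    (fun x hx => by simpa using h x hx) ⟨fun x y => congrArg (a * ·) (hB.eq x y)⟩ x y).2 hxy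
  simp only [LinearMap.smul_apply, smul_eq_mul] at hlt
  nlinarith [sq_nonneg a]

end BilinForm

section Derivative

variable {D E G : Type*} [NormedAddCommGroup D] [NormedSpace ℝ D] [NormedAddCommGroup E]
  [NormedSpace ℝ E] [NormedAddCommGroup G]

lemma tendsto_clm_apply [NormedSpace ℝ G] {α : Type*} {l : Filter α} {A : α → E →L[ℝ] G}
    {A₀ : E →L[ℝ] G} {x : α → E} {x₀ : E} (hA : Tendsto A l (𝓝 A₀)) (hx : Tendsto x l (𝓝 x₀)) :
    Tendsto (fun t => A t (x t)) l (𝓝 (A₀ x₀)) :=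
  (isBoundedBilinearMap_apply.continuous.tendsto (A₀, x₀)).comp (hA.prodMk_nhds hx)

lemma mem_range_of_hasDerivAt [NormedSpace ℝ G] [FiniteDimensional ℝ E] [FiniteDimensional ℝ G]
    {A : ℝ → E →L[ℝ] G} (hA : ContinuousAt A 0) (hinj : Function.Injective (A 0)) {y : ℝ → G}
    {y' : G} (hy : HasDerivAt y y' 0) (hy0 : y 0 = 0)
    (hmem : ∀ᶠ t in 𝓝[≠] 0, y t ∈ LinearMap.range (A t).toLinearMap) :
    y' ∈ LinearMap.range (A 0).toLinearMap := by
  have : CompleteSpace E := FiniteDimensional.complete ℝ E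
  obtain ⟨L', hL'⟩ := (A 0).toLinearMap.exists_leftInverse_of_injective
    (LinearMap.ker_eq_bot.2 hinj)
  set L : G →L[ℝ] E := LinearMap.toContinuousLinearMap L'
  have hL : L.comp (A 0) = 1 := ContinuousLinearMap.ext fun x => LinearMap.congr_fun hL' x
  have hT : Tendsto (fun t => L.comp (A t)) (𝓝[≠] 0) (𝓝 1) := by
    rw [← hL]
    exact ((continuous_const.clm_comp continuous_id).continuousAt.comp hA).tendsto.mono_left
      nhdsWithin_le_nhds
  have hunit : ∀ᶠ t in 𝓝[≠] 0, IsUnit (L.comp (A t)) :=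
    hT.eventually (Units.isOpen.mem_nhds isUnit_one)
  have hinv : Tendsto (fun t => Ring.inverse (L.comp (A t))) (𝓝[≠] 0) (𝓝 1) := by
    have hone := (NormedRing.inverse_continuousAt (1 : (E →L[ℝ] E)ˣ)).tendsto
    rw [Units.val_one, Ring.inverse_one] at hone
    exact hone.comp hT
  have hslope := tendsto_inv_smul_of_hasDerivAt hy hy0
  have hlim : Tendsto (fun t => A t (Ring.inverse (L.comp (A t)) (L (t⁻¹ • y t)))) (𝓝[≠] 0)
      (𝓝 (A 0 ((1 : E →L[ℝ] E) (L y')))) :=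
    tendsto_clm_apply (hA.tendsto.mono_left nhdsWithin_le_nhds)
      (tendsto_clm_apply hinv ((L.continuous.tendsto _).comp hslope))
  refine ⟨L y', tendsto_nhds_unique (hlim.congr' ?_) hslope⟩
  filter_upwards [hmem, hunit] with t ⟨x, hx⟩ ht
  have hx' : L (y t) = L.comp (A t) x := congrArg L hx.symm
  have hinvx : Ring.inverse (L.comp (A t)) (L.comp (A t) x) = x :=
    DFunLike.congr_fun (Ring.inverse_mul_cancel _ ht) x
  rw [map_smul, map_smul, map_smul, hx', hinvx]
  exact congrArg _ hx

lemma fderiv_fderiv_comp [NormedSpace ℝ G] {g : E → G} {c : D → E} {w : D}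
    (hg : ContDiffAt ℝ 2 g (c w)) (hc : ContDiffAt ℝ 2 c w) (X Y : D) :
    fderiv ℝ (fderiv ℝ (g ∘ c)) w X Y =
      fderiv ℝ (fderiv ℝ g) (c w) (fderiv ℝ c w X) (fderiv ℝ c w Y) +
        fderiv ℝ g (c w) (fderiv ℝ (fderiv ℝ c) w X Y) := by
  have hcomp : fderiv ℝ (g ∘ c) =ᶠ[𝓝 w] fun x => (fderiv ℝ g (c x)).comp (fderiv ℝ c x) := by
    filter_upwards [hc.continuousAt.eventually (hg.eventually (by simp)),
      hc.eventually (by simp)] with x hgx hcx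
    exact fderiv_comp x (hgx.differentiableAt two_ne_zero) (hcx.differentiableAt two_ne_zero)
  have hgc : DifferentiableAt ℝ (fun x => fderiv ℝ g (c x)) w :=
    (differentiableAt_fderiv hg).comp w (hc.differentiableAt two_ne_zero)
  have hgc' : fderiv ℝ (fun x => fderiv ℝ g (c x)) w =
      (fderiv ℝ (fderiv ℝ g) (c w)).comp (fderiv ℝ c w) :=
    fderiv_comp w (differentiableAt_fderiv hg) (hc.differentiableAt two_ne_zero)
  rw [hcomp.fderiv_eq, fderiv_clm_comp hgc (differentiableAt_fderiv hc), hgc', add_comm]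
  rfl

lemma secondForm_comp [InnerProductSpace ℝ G] {g : E → G} {c : D → E} {w : D}
    (hg : ContDiffAt ℝ 2 g (c w)) (hc : ContDiffAt ℝ 2 c w) {v : G}
    (hv : ∀ V, inner ℝ (fderiv ℝ g (c w) V) v = 0) (X Y : D) :
    secondForm (g ∘ c) w v X Y = secondForm g (c w) v (fderiv ℝ c w X) (fderiv ℝ c w Y) := by
  rw [secondForm_apply, fderiv_fderiv_comp hg hc, inner_add_left, hv, add_zero, secondForm_apply]

end Derivative

section Jacobian

lemma hasDerivAt_det_zero {ι : Type*} [Fintype ι] [DecidableEq ι] {A : ℝ → Matrix ι ι ℝ}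
    (hA : ∀ i j, ContDiffAt ℝ 1 (fun t => A t i j) 0) {x : ℝ → ι → ℝ}
    (hx : DifferentiableAt ℝ x 0) (hx0 : x 0 ≠ 0) (hxA : Matrix.vecMul (x 0) (A 0) = 0)
    (hderiv : ∀ l, HasDerivAt (fun t => Matrix.vecMul (x t) (A t) l) 0 0) :
    HasDerivAt (fun t => (A t).det) 0 0 := by
  obtain ⟨j, hj⟩ := Function.ne_iff.1 hx0
  have hdet0 : (A 0).det = 0 := Matrix.exists_vecMul_eq_zero_iff.1 ⟨x 0, hx0, hxA⟩
  have hcramer : (fun t => (A t).det * x t j) =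
      fun t => ∑ l, Matrix.vecMul (x t) (A t) l * (A t).adjugate l j := by
    funext t
    calc (A t).det * x t j = Matrix.vecMul (x t) (A t * (A t).adjugate) j := by
          rw [Matrix.mul_adjugate, Matrix.vecMul_smul, Matrix.vecMul_one, Pi.smul_apply,
            smul_eq_mul]
      _ = ∑ l, Matrix.vecMul (x t) (A t) l * (A t).adjugate l j := by
          rw [← Matrix.vecMul_vecMul]; rfl
  have hzero : HasDerivAt (fun t => (A t).det * x t j) 0 0 := by
    rw [hcramer]
    have hadj := fun l => ((contDiffAt_matrix_adjugate hA l j).differentiableAt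
      one_ne_zero).hasDerivAt
    simpa [hxA] using HasDerivAt.fun_sum (u := Finset.univ) fun l _ => (hderiv l).fun_mul (hadj l)
  have hdet := ((contDiffAt_matrix_det hA).differentiableAt one_ne_zero).hasDerivAt
  have hprod := (hdet.fun_mul (differentiableAt_pi.1 hx j).hasDerivAt).unique hzero
  rw [hdet0, zero_mul, add_zero] at hprod
  rwa [(mul_eq_zero.1 hprod).resolve_right hj] at hdet

variable {n : ℕ}

/-- The square matrix with the rows `A e₁, …, A eₙ, v`. -/
noncomputable def jacobianMatrix (A : Euc n →L[ℝ] Euc (n + 1)) (v : Euc (n + 1)) :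
    Matrix (Fin (n + 1)) (Fin (n + 1)) ℝ :=
  Matrix.of fun i j => (Fin.snoc (α := fun _ => Euc (n + 1)) (fun a : Fin n => A (stdVec a)) v i) j

lemma vecMul_jacobianMatrix (A : Euc n →L[ℝ] Euc (n + 1)) (v : Euc (n + 1)) (X : Euc n) (s : ℝ)
    (j : Fin (n + 1)) :
    Matrix.vecMul (Fin.snoc (α := fun _ => ℝ) X.ofLp s) (jacobianMatrix A v) j =
      (A X + s • v) j := by
  rw [map_eq_sum_stdVec]
  simp [Matrix.vecMul, dotProduct, Fin.sum_univ_castSucc, jacobianMatrix]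

lemma snoc_zero_ne_zero {X : Euc n} (hX : X ≠ 0) :
    Fin.snoc (α := fun _ => ℝ) X.ofLp (0 : ℝ) ≠ 0 := fun h =>
  hX (PiLp.ext fun a => by simpa using congrFun h a.castSucc)

lemma det_jacobianMatrix_eq_zero_iff {A : Euc n →L[ℝ] Euc (n + 1)} {v : Euc (n + 1)}
    (hv : v ≠ 0) (hA : ∀ X, inner ℝ (A X) v = 0) :
    (jacobianMatrix A v).det = 0 ↔ ¬ Function.Injective A := by
  rw [← Matrix.exists_vecMul_eq_zero_iff, injective_iff_map_eq_zero]
  push Not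
  constructor
  · rintro ⟨x, hx0, hx⟩
    obtain ⟨X, s, rfl⟩ : ∃ (X : Euc n) (s : ℝ), x = Fin.snoc (α := fun _ => ℝ) X.ofLp s :=
      ⟨WithLp.toLp 2 fun i => x i.castSucc, x (Fin.last n), (Fin.snoc_init_self x).symm⟩
    have hXs : A X + s • v = 0 := PiLp.ext fun j => by
      rw [← vecMul_jacobianMatrix, hx]; rfl
    have hs : s = 0 := by
      have hinner := congrArg (fun z => inner ℝ z v) hXs
      simpa [inner_add_left, hA, real_inner_smul_left, hv] using hinner
    subst hs
    refine ⟨X, by simpa using hXs, ?_⟩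
    rintro rfl
    refine hx0 (funext fun i => ?_)
    refine Fin.lastCases ?_ (fun a => ?_) i <;> simp
  · rintro ⟨X, hX, hX0⟩
    exact ⟨_, snoc_zero_ne_zero hX0, funext fun j => by rw [vecMul_jacobianMatrix]; simp [hX]⟩

/-- The Jacobian determinant `det (∂₁g, …, ∂ₙg, ν)` of a map `g` with normal field `ν`. -/
noncomputable def jacobianDet (g ν : Euc n → Euc (n + 1)) (v : Euc n) : ℝ :=
  (jacobianMatrix (fderiv ℝ g v) (ν v)).det

variable {g ν : Euc n → Euc (n + 1)} {u η : Euc n}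

lemma contDiffAt_jacobianMatrix {r : WithTop ℕ∞} (hg : ContDiffAt ℝ (r + 1) g u)
    (hν : ContDiffAt ℝ r ν u) (i j : Fin (n + 1)) :
    ContDiffAt ℝ r (fun v => jacobianMatrix (fderiv ℝ g v) (ν v) i j) u := by
  refine Fin.lastCases ?_ (fun a => ?_) i
  · simpa only [jacobianMatrix, Matrix.of_apply, Fin.snoc_last] using contDiffAt_euclidean.1 hν j
  · simpa only [jacobianMatrix, Matrix.of_apply, Fin.snoc_castSucc] using
      contDiffAt_euclidean.1 ((hg.fderiv_right (m := r) le_rfl).clm_apply contDiffAt_const) j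

lemma contDiffAt_jacobianDet {r : WithTop ℕ∞} (hg : ContDiffAt ℝ (r + 1) g u)
    (hν : ContDiffAt ℝ r ν u) : ContDiffAt ℝ r (jacobianDet g ν) u :=
  contDiffAt_matrix_det (contDiffAt_jacobianMatrix hg hν)

lemma hasDerivAt_jacobianDet_line (hg : ContDiffAt ℝ 2 g u) (hν : ContDiffAt ℝ 1 ν u)
    (η : Euc n) : HasDerivAt (fun t : ℝ => jacobianDet g ν (u + t • η))
      (fderiv ℝ (jacobianDet g ν) u η) 0 := by
  have hJ : HasFDerivAt (jacobianDet g ν) (fderiv ℝ (jacobianDet g ν) u) (u + (0 : ℝ) • η) := by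
    rw [zero_smul, add_zero]
    exact ((contDiffAt_jacobianDet (hg.of_le (by norm_num)) hν).differentiableAt
      one_ne_zero).hasFDerivAt
  exact HasFDerivAt.comp_hasDerivAt (f := fun t : ℝ => u + t • η) 0 hJ (hasDerivAt_line u η)

lemma fderiv_jacobianDet_eq_zero (hg : ContDiffAt ℝ 2 g u) (hν : ContDiffAt ℝ 1 ν u)
    (hη0 : η ≠ 0) (hη : fderiv ℝ g u η = 0)
    (hηη : fderiv ℝ (fderiv ℝ g) u η η ∈ LinearMap.range (fderiv ℝ g u).toLinearMap) :
    fderiv ℝ (jacobianDet g ν) u η = 0 := by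
  obtain ⟨Y, hY⟩ := hηη
  have hline : ContDiffAt ℝ 1 (fun t : ℝ => u + t • η) 0 :=
    contDiffAt_const.add (contDiffAt_id.smul contDiffAt_const)
  refine (hasDerivAt_jacobianDet_line hg hν η).unique (hasDerivAt_det_zero
    (x := fun t => Fin.snoc (α := fun _ => ℝ) (η + t • (-Y)).ofLp 0) (fun i j => ?_) ?_ ?_ ?_
    fun l => ?_)
  · refine ContDiffAt.comp (f := fun t : ℝ => u + t • η)
      (g := fun v => jacobianMatrix (fderiv ℝ g v) (ν v) i j) 0 ?_ hline
    rw [zero_smul, add_zero]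
    exact contDiffAt_jacobianMatrix (hg.of_le (by norm_num)) hν i j
  · refine differentiableAt_pi.2 fun i => Fin.lastCases ?_ (fun a => ?_) i
    · simp only [Fin.snoc_last]
      exact differentiableAt_const _
    · simp only [Fin.snoc_castSucc, PiLp.add_apply, PiLp.smul_apply]
      fun_prop
  · simpa using snoc_zero_ne_zero hη0
  · refine funext fun j => ?_
    rw [vecMul_jacobianMatrix]
    simp [hη]
  · simp only [vecMul_jacobianMatrix, zero_smul, add_zero]
    have hD := hasDerivAt_fderiv_line hg (hasDerivAt_line η (-Y)) η
    rw [zero_smul, add_zero, map_neg, ← hY, ContinuousLinearMap.coe_coe, add_neg_cancel] at hD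
    exact (EuclideanSpace.proj l : Euc (n + 1) →L[ℝ] ℝ).hasFDerivAt.comp_hasDerivAt 0 hD

end Jacobian

section A2

variable {k : ℕ} {g ν : Euc (k + 1) → Euc (k + 1 + 1)} {c : Euc k → Euc (k + 1)} {w : Euc k}
  {η : Euc (k + 1)} {δ : ℝ}

/-- The Euclidean picture of a front `g` with unit normal field `ν` near an `A₂`-point `c w`, where
`c` parametrizes the singular set near `w`. -/
structure IsA2ParamAt (g ν : Euc (k + 1) → Euc (k + 1 + 1)) (c : Euc k → Euc (k + 1))
    (w : Euc k) : Prop where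
  isUnitNormalAt : IsUnitNormalAt g ν (c w)
  immersion : ∀ X, fderiv ℝ g (c w) X = 0 → fderiv ℝ ν (c w) X = 0 → X = 0
  contDiffAt : ContDiffAt ℝ 3 c w
  injective : Function.Injective (fderiv ℝ c w)
  singular : ∀ᶠ x in 𝓝 w, jacobianDet g ν (c x) = 0
  nondegenerate : fderiv ℝ (jacobianDet g ν) (c w) ≠ 0
  isCompl : ∀ᶠ x in 𝓝 w, IsCompl (LinearMap.ker (fderiv ℝ g (c x)).toLinearMap)
    (LinearMap.range (fderiv ℝ c x).toLinearMap)

namespace IsA2ParamAt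

lemma fderiv_comp_apply (h : IsA2ParamAt g ν c w) (X : Euc k) :
    fderiv ℝ (g ∘ c) w X = fderiv ℝ g (c w) (fderiv ℝ c w X) := by
  rw [fderiv_comp w (h.isUnitNormalAt.contDiffAt.differentiableAt three_ne_zero)
    (h.contDiffAt.differentiableAt three_ne_zero)]
  rfl

lemma contDiffAt_comp (h : IsA2ParamAt g ν c w) : ContDiffAt ℝ 3 (g ∘ c) w :=
  h.isUnitNormalAt.contDiffAt.comp w h.contDiffAt

lemma injective_fderiv_comp (h : IsA2ParamAt g ν c w) :
    Function.Injective (fderiv ℝ (g ∘ c) w) := by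
  refine (injective_iff_map_eq_zero _).2 fun X hX => ?_
  rw [h.fderiv_comp_apply] at hX
  have hcX := h.isCompl.self_of_nhds.disjoint.le_bot
    (Submodule.mem_inf.2 ⟨LinearMap.mem_ker.2 hX, LinearMap.mem_range_self _ X⟩)
  exact h.injective (((Submodule.mem_bot ℝ).1 hcX).trans (map_zero _).symm)

lemma range_fderiv_le (h : IsA2ParamAt g ν c w) : ∀ᶠ x in 𝓝 w,
    LinearMap.range (fderiv ℝ g (c x)).toLinearMap ≤
      LinearMap.range (fderiv ℝ (g ∘ c) x).toLinearMap := by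
  filter_upwards [h.isCompl, h.contDiffAt.eventually (by simp),
    h.contDiffAt.continuousAt.eventually (h.isUnitNormalAt.contDiffAt.eventually (by simp))]
    with x hx hc hg
  rintro _ ⟨V, rfl⟩
  obtain ⟨a, ha, _, ⟨b, rfl⟩, rfl⟩ :=
    Submodule.mem_sup.1 (hx.sup_eq_top ▸ Submodule.mem_top : V ∈ _)
  refine ⟨b, ?_⟩
  rw [map_add, LinearMap.mem_ker.1 ha, zero_add, fderiv_comp x
    (hg.differentiableAt three_ne_zero) (hc.differentiableAt three_ne_zero)]
  rfl

lemma exists_null (h : IsA2ParamAt g ν c w) : ∃ η ≠ 0, fderiv ℝ g (c w) η = 0 := by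
  have hsing := (det_jacobianMatrix_eq_zero_iff h.isUnitNormalAt.normal_ne_zero
    h.isUnitNormalAt.normal.self_of_nhds).1 h.singular.self_of_nhds
  rw [injective_iff_map_eq_zero] at hsing
  push Not at hsing
  obtain ⟨η, hη, hη0⟩ := hsing
  exact ⟨η, hη0, hη⟩

lemma fderiv_jacobianDet_ne_zero (h : IsA2ParamAt g ν c w) (hη0 : η ≠ 0)
    (hη : fderiv ℝ g (c w) η = 0) : fderiv ℝ (jacobianDet g ν) (c w) η ≠ 0 := by
  intro hJη
  have hcompl := h.isCompl.self_of_nhds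
  have hdim : Module.finrank ℝ (LinearMap.ker (fderiv ℝ g (c w)).toLinearMap) = 1 := by
    have hadd := Submodule.finrank_add_eq_of_isCompl hcompl
    rw [LinearMap.finrank_range_of_inj h.injective, finrank_euclideanSpace_fin,
      finrank_euclideanSpace_fin] at hadd
    omega
  have hJc : ∀ X, fderiv ℝ (jacobianDet g ν) (c w) (fderiv ℝ c w X) = 0 := by
    have hJ : DifferentiableAt ℝ (jacobianDet g ν) (c w) :=
      (contDiffAt_jacobianDet (r := 1) (h.isUnitNormalAt.contDiffAt.of_le (by norm_num))
        (h.isUnitNormalAt.contDiffAt_normal.of_le (by norm_num))).differentiableAt one_ne_zero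
    have hzero : jacobianDet g ν ∘ c =ᶠ[𝓝 w] fun _ => (0 : ℝ) := h.singular
    intro X
    have hX := congrArg (fun L : Euc k →L[ℝ] ℝ => L X) hzero.fderiv_eq
    rwa [fderiv_comp w hJ (h.contDiffAt.differentiableAt three_ne_zero), fderiv_const_apply] at hX
  refine h.nondegenerate (ContinuousLinearMap.ext fun V => ?_)
  obtain ⟨a, ha, _, ⟨b, rfl⟩, rfl⟩ :=
    Submodule.mem_sup.1 (hcompl.sup_eq_top ▸ Submodule.mem_top : V ∈ _)
  obtain ⟨s, hs⟩ := exists_smul_eq_of_finrank_eq_one hdim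
    (x := ⟨η, LinearMap.mem_ker.2 hη⟩) (by simpa using hη0) ⟨a, ha⟩
  have hsa : s • η = a := congrArg Subtype.val hs
  rw [map_add, ← hsa, map_smul, hJη, smul_zero, zero_add]
  exact hJc b

lemma fderiv_normal_ne_zero (h : IsA2ParamAt g ν c w) (hη0 : η ≠ 0)
    (hη : fderiv ℝ g (c w) η = 0) : fderiv ℝ ν (c w) η ≠ 0 := fun hν =>
  hη0 (h.immersion η hη hν)

lemma mem_range_of_inner_normals_eq_zero (h : IsA2ParamAt g ν c w) (hη0 : η ≠ 0)
    (hη : fderiv ℝ g (c w) η = 0) {v : Euc (k + 1 + 1)} (hv : inner ℝ (ν (c w)) v = 0)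
    (hv' : inner ℝ (fderiv ℝ ν (c w) η) v = 0) :
    v ∈ LinearMap.range (fderiv ℝ (g ∘ c) w).toLinearMap := by
  have hν := h.isUnitNormalAt
  have hli : LinearIndependent ℝ ![ν (c w), fderiv ℝ ν (c w) η] := by
    refine LinearIndependent.pair_symm_iff.1 (linearIndependent_pair_of_map
      (L := innerₗ _ (ν (c w))) (h.fderiv_normal_ne_zero hη0 hη) (hν.inner_normal_fderiv η) ?_)
    rw [innerₗ_apply_apply, inner_self_ne_zero]
    exact hν.normal_ne_zero
  refine mem_range_of_inner_eq_zero h.injective_fderiv_comp hli (by simp) ?_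
    (Fin.forall_fin_two.2 ⟨hv, hv'⟩)
  refine Fin.forall_fin_two.2 ⟨fun X => ?_, fun X => ?_⟩
  · simp only [ContinuousLinearMap.coe_coe, h.fderiv_comp_apply]
    exact hν.inner_normal_fderiv_left _
  · simp only [ContinuousLinearMap.coe_coe, h.fderiv_comp_apply]
    rw [Matrix.cons_val_one, Matrix.cons_val_fin_one, real_inner_comm]
    exact hν.inner_fderiv_null hη _

lemma secondForm_null_ne_zero (h : IsA2ParamAt g ν c w) (hη0 : η ≠ 0)
    (hη : fderiv ℝ g (c w) η = 0) :
    secondForm g (c w) (fderiv ℝ ν (c w) η) η η ≠ 0 := by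
  intro ha
  have hν := h.isUnitNormalAt
  have hperp : inner ℝ (ν (c w)) (fderiv ℝ (fderiv ℝ g) (c w) η η) = 0 := by
    rw [real_inner_comm, ← secondForm_apply, hν.secondForm_normal, hη, inner_zero_left, neg_zero]
  rw [secondForm_apply, real_inner_comm] at ha
  obtain ⟨X, hX⟩ := h.mem_range_of_inner_normals_eq_zero hη0 hη hperp ha
  refine h.fderiv_jacobianDet_ne_zero hη0 hη (fderiv_jacobianDet_eq_zero hν.contDiffAt_two
    (hν.contDiffAt_normal.of_le (by norm_num)) hη0 hη ⟨fderiv ℝ c w X, ?_⟩)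
  rw [← hX]
  exact (h.fderiv_comp_apply X).symm

lemma eventually_injective_fderiv_line (h : IsA2ParamAt g ν c w) (hη0 : η ≠ 0)
    (hη : fderiv ℝ g (c w) η = 0) :
    ∀ᶠ t : ℝ in 𝓝[≠] 0, Function.Injective (fderiv ℝ g (c w + t • η)) := by
  have hν := h.isUnitNormalAt
  have hne := (hasDerivAt_jacobianDet_line hν.contDiffAt_two
    (hν.contDiffAt_normal.of_le (by norm_num)) η).eventually_ne (c := 0)
    (h.fderiv_jacobianDet_ne_zero hη0 hη)
  filter_upwards [hne, ((tendsto_line (c w) η).eventually hν.eventually).filter_mono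
    nhdsWithin_le_nhds] with t hJ ht
  exact not_not.1 fun hinj =>
    hJ ((det_jacobianMatrix_eq_zero_iff ht.normal_ne_zero ht.normal.self_of_nhds).2 hinj)

lemma exists_fderiv_fderiv_null_add_eq_zero (h : IsA2ParamAt g ν c w)
    (hη : fderiv ℝ g (c w) η = 0) (X : Euc k) :
    ∃ X', fderiv ℝ (fderiv ℝ g) (c w) η (fderiv ℝ c w X) + fderiv ℝ g (c w) X' = 0 := by
  have hg := h.isUnitNormalAt.contDiffAt_two
  have hcX : HasDerivAt (fun t : ℝ => c (w + t • X)) (fderiv ℝ c w X) 0 := by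
    have hc : HasFDerivAt c (fderiv ℝ c w) (w + (0 : ℝ) • X) := by
      simpa using (h.contDiffAt.differentiableAt three_ne_zero).hasFDerivAt
    exact HasFDerivAt.comp_hasDerivAt (f := fun t : ℝ => w + t • X) 0 hc (hasDerivAt_line w X)
  have hy : HasDerivAt (fun t : ℝ => fderiv ℝ g (c (w + t • X)) η)
      (fderiv ℝ (fderiv ℝ g) (c w) η (fderiv ℝ c w X)) 0 := by
    have hD : HasFDerivAt (fun v => fderiv ℝ g v η)
        (fderiv ℝ (fun v => fderiv ℝ g v η) (c w)) (c (w + (0 : ℝ) • X)) := by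
      simpa using (differentiableAt_fderiv_apply hg η).hasFDerivAt
    rw [fderiv_fderiv_comm hg, ← fderiv_fderiv_apply hg]
    exact HasFDerivAt.comp_hasDerivAt (f := fun t : ℝ => c (w + t • X)) 0 hD hcX
  have hA : ContinuousAt (fun t : ℝ => fderiv ℝ (g ∘ c) (w + t • X)) 0 := by
    refine ContinuousAt.comp (f := fun t : ℝ => w + t • X) ?_ (hasDerivAt_line w X).continuousAt
    rw [zero_smul, add_zero]
    exact (h.contDiffAt_comp.fderiv_right (m := 0) (by norm_num)).continuousAt
  obtain ⟨Y, hY⟩ := mem_range_of_hasDerivAt hA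
    (by rw [zero_smul, add_zero]; exact h.injective_fderiv_comp) hy (by simpa using hη)
    ((((tendsto_line w X).eventually h.range_fderiv_le).filter_mono nhdsWithin_le_nhds).mono
      fun t ht => ht (LinearMap.mem_range_self _ η))
  refine ⟨-fderiv ℝ c w Y, ?_⟩
  rw [← hY, map_neg, ← h.fderiv_comp_apply, zero_smul, add_zero]
  exact add_neg_cancel _

lemma secondForm_comp_eq_zero_and_le (h : IsA2ParamAt g ν c w) (hη0 : η ≠ 0)
    (hη : fderiv ℝ g (c w) η = 0) {Z : ℝ → Euc (k + 1)} (hZ : DifferentiableAt ℝ Z 0)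
    (hZ0 : Z 0 = η) (hδ : 0 ≤ δ)
    (hK : ∀ᶠ t : ℝ in 𝓝[≠] 0, ∀ Y, LinearIndependent ℝ ![Y, Z t] →
      δ ≤ sectionalCurvature (pullbackMetric g) (c w + t • η) Y (Z t))
    {X : Euc k} (hX : X ≠ 0) :
    secondForm (g ∘ c) w (ν (c w)) X X = 0 ∧ ∃ Q : ℝ, 0 < Q ∧ δ * Q ≤
      -secondForm g (c w) (fderiv ℝ ν (c w) η) η η *
        secondForm (g ∘ c) w (fderiv ℝ ν (c w) η) X X := by
  have hν := h.isUnitNormalAt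
  have hc : ContDiffAt ℝ 2 c w := h.contDiffAt.of_le (by norm_num)
  obtain ⟨X', hX'⟩ := h.exists_fderiv_fderiv_null_add_eq_zero hη X
  have hgX : fderiv ℝ g (c w) (fderiv ℝ c w X) ≠ 0 := by
    rw [← h.fderiv_comp_apply]
    exact (map_ne_zero_iff _ h.injective_fderiv_comp).2 hX
  obtain ⟨hzero, Q, hQ, hle⟩ := hν.secondForm_eq_zero_and_le_of_curvature_ge hη
    (h.secondForm_null_ne_zero hη0 hη) (h.eventually_injective_fderiv_line hη0 hη) hgX hX' hZ hZ0
    hδ hK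
  rw [secondForm_comp hν.contDiffAt_two hc hν.normal.self_of_nhds,
    secondForm_comp hν.contDiffAt_two hc (hν.inner_fderiv_null hη)]
  exact ⟨hzero, Q, hQ, by linarith⟩

lemma sectionalCurvature_comp (h : IsA2ParamAt g ν c w) (hη0 : η ≠ 0)
    (hη : fderiv ℝ g (c w) η = 0)
    (hzero : ∀ X, secondForm (g ∘ c) w (ν (c w)) X X = 0) (X Y : Euc k) :
    sectionalCurvature (pullbackMetric (g ∘ c)) w X Y =
      (secondForm (g ∘ c) w (fderiv ℝ ν (c w) η) X X *
          secondForm (g ∘ c) w (fderiv ℝ ν (c w) η) Y Y -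
        secondForm (g ∘ c) w (fderiv ℝ ν (c w) η) X Y ^ 2) /
          inner ℝ (fderiv ℝ ν (c w) η) (fderiv ℝ ν (c w) η) /
        gramDet (fderiv ℝ (g ∘ c) w X) (fderiv ℝ (g ∘ c) w Y) := by
  have hν := h.isUnitNormalAt
  have hn := h.fderiv_normal_ne_zero hη0 hη
  have hsymm := isSymm_secondForm (h.contDiffAt_comp.of_le (by norm_num)) (ν (c w))
  have hform : secondForm (g ∘ c) w (ν (c w)) = 0 :=
    LinearMap.BilinForm.ext_of_isSymm ⟨hsymm.eq⟩ LinearMap.BilinForm.isSymm_zero hzero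
  refine sectionalCurvature_pullbackMetric_of_normal h.contDiffAt_comp h.injective_fderiv_comp hn
    (fun V => ?_) (fun X Y => h.mem_range_of_inner_normals_eq_zero hη0 hη ?_ ?_) X Y
  · rw [real_inner_comm, h.fderiv_comp_apply, hν.inner_fderiv_null hη]
  · rw [inner_sub_right, inner_smul_right, hν.inner_normal_fderiv, mul_zero, sub_zero,
      real_inner_comm, ← secondForm_apply, hform]
    rfl
  · rw [inner_sub_right, inner_smul_right, div_mul_cancel₀ _ (inner_self_ne_zero.2 hn),
      secondForm_apply, real_inner_comm, sub_self]

theorem sectionalCurvature_comp_nonneg_and_pos (h : IsA2ParamAt g ν c w) (hη0 : η ≠ 0)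
    (hη : fderiv ℝ g (c w) η = 0) {Z : ℝ → Euc (k + 1)} (hZ : DifferentiableAt ℝ Z 0)
    (hZ0 : Z 0 = η) (hδ : 0 ≤ δ)
    (hK : ∀ᶠ t : ℝ in 𝓝[≠] 0, ∀ Y, LinearIndependent ℝ ![Y, Z t] →
      δ ≤ sectionalCurvature (pullbackMetric g) (c w + t • η) Y (Z t))
    {X Y : Euc k} (hXY : LinearIndependent ℝ ![X, Y]) :
    0 ≤ sectionalCurvature (pullbackMetric (g ∘ c)) w X Y ∧
      (0 < δ → 0 < sectionalCurvature (pullbackMetric (g ∘ c)) w X Y) := by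
  have hcore := fun X hX => h.secondForm_comp_eq_zero_and_le hη0 hη hZ hZ0 hδ hK (X := X) hX
  have hzero : ∀ X, secondForm (g ∘ c) w (ν (c w)) X X = 0 := fun X => by
    obtain rfl | hX := eq_or_ne X 0
    · simp
    · exact (hcore X hX).1
  have hsymm := isSymm_secondForm (h.contDiffAt_comp.of_le (by norm_num)) (fderiv ℝ ν (c w) η)
  have ha := neg_ne_zero.2 (h.secondForm_null_ne_zero hη0 hη)
  have hn := real_inner_self_pos.2 (h.fderiv_normal_ne_zero hη0 hη)
  have hgram : 0 < gramDet (fderiv ℝ (g ∘ c) w X) (fderiv ℝ (g ∘ c) w Y) :=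
    gramDet_map_pos (L := (fderiv ℝ (g ∘ c) w).toLinearMap) h.injective_fderiv_comp hXY
  rw [h.sectionalCurvature_comp hη0 hη hzero]
  refine ⟨div_nonneg (div_nonneg (sub_nonneg.2 (bilinForm_sq_le hsymm ha (fun V => ?_) X Y))
    hn.le) hgram.le, fun hδ' => div_pos (div_pos (sub_pos.2 (bilinForm_sq_lt hsymm
      (a := -secondForm g (c w) (fderiv ℝ ν (c w) η) η η) (fun V hV => ?_) hXY)) hn) hgram⟩
  · obtain rfl | hV := eq_or_ne V 0
    · simp
    · obtain ⟨-, Q, hQ, hle⟩ := hcore V hV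
      exact (mul_nonneg hδ hQ.le).trans hle
  · obtain ⟨-, Q, hQ, hle⟩ := hcore V hV
    exact (mul_pos hδ' hQ).trans_le hle

end IsA2ParamAt

end A2

section Straightening

lemma exists_openPartialHomeomorph_contDiffOn_symm {E F : Type*} [NormedAddCommGroup E]
    [NormedSpace ℝ E] [CompleteSpace E] [NormedAddCommGroup F] [NormedSpace ℝ F] {n : WithTop ℕ∞}
    (hn : n ≠ 0) {G : E → F} {B : Set E} (hB : IsOpen B) (hG : ContDiffOn ℝ n G B) {y : E}
    (hy : y ∈ B) {A : E ≃L[ℝ] F} (hA : HasFDerivAt G (A : E →L[ℝ] F) y) :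
    ∃ e : OpenPartialHomeomorph E F, ⇑e = G ∧ y ∈ e.source ∧ e.source ⊆ B ∧
      ContDiffOn ℝ n e.symm e.target := by
  have hG' : ∀ x ∈ B, ContDiffAt ℝ n G x := fun x hx => hG.contDiffAt (hB.mem_nhds hx)
  have hB' : IsOpen (B ∩ fderiv ℝ G ⁻¹' Set.range ((↑) : (E ≃L[ℝ] F) → E →L[ℝ] F)) :=
    (hG.continuousOn_fderiv_of_isOpen hB
      (ENat.one_le_iff_ne_zero_withTop.2 hn)).isOpen_inter_preimage hB
        (ContinuousLinearEquiv.isOpen (𝕜 := ℝ))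
  have hs : HasStrictFDerivAt G (A : E →L[ℝ] F) y := (hG' y hy).hasStrictFDerivAt' hA hn
  refine ⟨(hs.toOpenPartialHomeomorph G).restrOpen _ hB', rfl,
    ⟨hs.mem_toOpenPartialHomeomorph_source, hy, A, hA.fderiv.symm⟩, fun x hx => hx.2.1,
    fun z hz => ?_⟩
  obtain ⟨-, hx, A', hA'⟩ := OpenPartialHomeomorph.map_target _ hz
  refine (OpenPartialHomeomorph.contDiffAt_symm _ hz (f₀' := A') ?_ (hG' _ hx)).contDiffWithinAt
  rw [hA']
  exact ((hG' _ hx).differentiableAt hn).hasFDerivAt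

lemma exists_continuousLinearEquiv_prod_snd_eq {V : Type*} [NormedAddCommGroup V] [NormedSpace ℝ V]
    [FiniteDimensional ℝ V] {k : ℕ} (hV : Module.finrank ℝ V = k + 1) {l : V →L[ℝ] ℝ}
    (hl : l ≠ 0) : ∃ A : V ≃L[ℝ] Euc k × ℝ, ∀ x, (A x).2 = l x := by
  have hsurj : Function.Surjective l.toLinearMap :=
    LinearMap.surjective fun h => hl (ContinuousLinearMap.coe_injective h)
  have hker : Module.finrank ℝ (LinearMap.ker l.toLinearMap) = Module.finrank ℝ (Euc k) := by
    have hadd := LinearMap.finrank_range_add_finrank_ker l.toLinearMap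
    rw [LinearMap.range_eq_top.2 hsurj, finrank_top, Module.finrank_self] at hadd
    rw [finrank_euclideanSpace_fin]
    omega
  obtain ⟨L, hL⟩ := (LinearEquiv.ofFinrankEq _ _ hker).toLinearMap.exists_extend
  have hinj : Function.Injective (L.prod l.toLinearMap) := by
    refine (injective_iff_map_eq_zero _).2 fun x hx => ?_
    obtain ⟨hLx, hlx⟩ := Prod.mk.inj hx
    have hx0 : LinearEquiv.ofFinrankEq _ _ hker ⟨x, hlx⟩ = 0 :=
      (LinearMap.congr_fun hL ⟨x, hlx⟩).symm.trans hLx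
    exact congrArg Subtype.val ((LinearEquiv.map_eq_zero_iff _).1 hx0)
  have hdim : Module.finrank ℝ V = Module.finrank ℝ (Euc k × ℝ) := by simp [hV]
  exact ⟨(LinearEquiv.ofInjectiveOfFinrankEq _ hinj hdim).toContinuousLinearEquiv, fun x => rfl⟩

lemma exists_openPartialHomeomorph_snd_eq {V : Type*} [NormedAddCommGroup V] [NormedSpace ℝ V]
    [FiniteDimensional ℝ V] {k : ℕ} (hV : Module.finrank ℝ V = k + 1) {n : WithTop ℕ∞}
    (hn : n ≠ 0) {J : V → ℝ} {B : Set V} (hB : IsOpen B) (hJ : ContDiffOn ℝ n J B) {y : V}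
    (hy : y ∈ B) (hdJ : fderiv ℝ J y ≠ 0) :
    ∃ e : OpenPartialHomeomorph V (Euc k × ℝ), y ∈ e.source ∧ e.source ⊆ B ∧
      ContDiffOn ℝ n e e.source ∧ ContDiffOn ℝ n e.symm e.target ∧ ∀ x, (e x).2 = J x := by
  obtain ⟨A, hA⟩ := exists_continuousLinearEquiv_prod_snd_eq hV hdJ
  have hG : ContDiffOn ℝ n (fun x => ((A x).1, J x)) B :=
    A.contDiff.fst.contDiffOn.prodMk hJ
  have hdG : HasFDerivAt (fun x => ((A x).1, J x)) (A : V →L[ℝ] Euc k × ℝ) y := by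
    have hJy := ((hJ.contDiffAt (hB.mem_nhds hy)).differentiableAt hn).hasFDerivAt
    convert A.hasFDerivAt.fst.prodMk hJy using 1
    ext x
    · rfl
    · exact hA x
  have := FiniteDimensional.complete ℝ V
  obtain ⟨e, he, hye, heB, hsymm⟩ := exists_openPartialHomeomorph_contDiffOn_symm hn hB hG hy hdG
  exact ⟨e, hye, heB, he ▸ hG.mono heB, hsymm, fun x => by rw [he]⟩

end Straightening

section LocalParam

lemma isEmbedding_domRestrict_of_leftInvOn {X Y : Type*} [TopologicalSpace X] [TopologicalSpace Y]
    {γ : X → Y} {h : Y → X} {W : Set X} (hγ : ContinuousOn γ W) (hh : ContinuousOn h (γ '' W))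
    (hinv : Set.LeftInvOn h γ W) : IsEmbedding (W.domRestrict γ) := by
  have hγ' := hγ.mapsToRestrict (Set.mapsTo_image γ W)
  have hh' := hh.domRestrict
  refine IsEmbedding.subtypeVal.comp (IsEmbedding.of_comp hγ' hh' ?_)
  convert IsEmbedding.subtypeVal (p := (· ∈ W)) using 1
  exact funext fun x => hinv x.2

variable {m k : ℕ} {M : Type*} [TopologicalSpace M] [ChartedSpace (Euc m) M]

lemma fderiv_comp_mfderiv {F : Type*} [NormedAddCommGroup F] [NormedSpace ℝ F] {γ : Euc k → M}
    {f : M → F} {x : Euc k} (hf : MDifferentiableAt (𝓡 m) 𝓘(ℝ, F) f (γ x))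
    (hγ : MDifferentiableAt (𝓡 k) (𝓡 m) γ x) (V : Euc k) :
    fderiv ℝ (f ∘ γ) x V = mfderiv (𝓡 m) 𝓘(ℝ, F) f (γ x) (mfderiv (𝓡 k) (𝓡 m) γ x V) := by
  rw [← mfderiv_eq_fderiv, mfderiv_comp x hf hγ]
  rfl

namespace IsLocalParam

variable {S : Set M} {W : Set (Euc k)} {γ : Euc k → M}

lemma mem (hγ : IsLocalParam m k S W γ) {x : Euc k} (hx : x ∈ W) : γ x ∈ S := by
  obtain ⟨O, -, hO⟩ := hγ.image
  exact (hO.subset (Set.mem_image_of_mem γ hx)).1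

lemma contMDiffAt (hγ : IsLocalParam m k S W γ) {x : Euc k} (hx : x ∈ W) :
    ContMDiffAt (𝓡 k) (𝓡 m) ∞ γ x :=
  hγ.smooth.contMDiffAt (hγ.isOpen.mem_nhds hx)

lemma mdifferentiableAt (hγ : IsLocalParam m k S W γ) {x : Euc k} (hx : x ∈ W) :
    MDifferentiableAt (𝓡 k) (𝓡 m) γ x :=
  (hγ.contMDiffAt hx).mdifferentiableAt (by simp)

lemma of_leftInvOn {h : M → Euc k} (hW : IsOpen W) (hγ : ContMDiffOn (𝓡 k) (𝓡 m) ∞ γ W)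
    (hh : ∀ x ∈ W, MDifferentiableAt (𝓡 m) (𝓡 k) h (γ x)) (hinv : Set.LeftInvOn h γ W)
    (himage : ∃ O : Set M, IsOpen O ∧ γ '' W = S ∩ O) : IsLocalParam m k S W γ where
  isOpen := hW
  smooth := hγ
  immersion x hx := by
    have hd : MDifferentiableAt (𝓡 k) (𝓡 m) γ x :=
      (hγ.contMDiffAt (hW.mem_nhds hx)).mdifferentiableAt (by simp)
    have hid : h ∘ γ =ᶠ[𝓝 x] id := eventually_of_mem (hW.mem_nhds hx) fun z hz => hinv hz
    refine Function.LeftInverse.injective (g := mfderiv (𝓡 m) (𝓡 k) h (γ x)) fun V => ?_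
    rw [← fderiv_comp_mfderiv (hh x hx) hd V, hid.fderiv_eq, fderiv_id]
    rfl
  embedding := isEmbedding_domRestrict_of_leftInvOn hγ.continuousOn
    (Set.forall_mem_image.2 fun x hx => (hh x hx).continuousAt.continuousWithinAt) hinv
  image := himage

lemma of_sliceChart {F : Type*} [NormedAddCommGroup F] [NormedSpace ℝ F]
    (ψ : OpenPartialHomeomorph M (Euc k × F))
    (hψ : ∀ q ∈ ψ.source, MDifferentiableAt (𝓡 m) 𝓘(ℝ, Euc k × F) ψ q)
    (hsymm : ContMDiffOn 𝓘(ℝ, Euc k × F) (𝓡 m) ∞ ψ.symm ψ.target)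
    (hS : ∀ q ∈ ψ.source, q ∈ S ↔ (ψ q).2 = 0) :
    IsLocalParam m k S ((fun x => (x, 0)) ⁻¹' ψ.target) fun x => ψ.symm (x, 0) := by
  have hmem : ∀ x : Euc k, (x, 0) ∈ ψ.target → ψ.symm (x, 0) ∈ ψ.source := fun x hx =>
    ψ.map_target hx
  refine of_leftInvOn (h := fun q => (ψ q).1) (ψ.open_target.preimage (by fun_prop)) ?_ ?_ ?_
    ⟨ψ.source, ψ.open_source, ?_⟩
  · have hincl : ContDiff ℝ ∞ (fun x : Euc k => (x, (0 : F))) := contDiff_id.prodMk contDiff_const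
    exact hsymm.comp hincl.contMDiff.contMDiffOn fun x hx => hx
  · intro x hx
    exact MDifferentiableAt.comp (g := Prod.fst) (I' := 𝓘(ℝ, Euc k × F)) _
      differentiableAt_fst.mdifferentiableAt (hψ _ (hmem x hx))
  · exact fun x hx => congrArg Prod.fst (ψ.right_inv hx)
  · ext q
    constructor
    · rintro ⟨x, hx, rfl⟩
      refine ⟨(hS _ (hmem x hx)).2 ?_, hmem x hx⟩
      rw [ψ.right_inv hx]
    · rintro ⟨hqS, hq⟩
      have hψq : ((ψ q).1, 0) = ψ q := Prod.ext rfl ((hS q hq).1 hqS).symm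
      exact ⟨(ψ q).1, by simpa only [Set.mem_preimage, hψq] using ψ.map_source hq,
        by simp only [hψq, ψ.left_inv hq]⟩

end IsLocalParam

end LocalParam

section Chart

variable {m : ℕ} {M : Type*} [TopologicalSpace M] [ChartedSpace (Euc m) M]
  [IsManifold (𝓡 m) ∞ M] {F : Type*} [NormedAddCommGroup F] [NormedSpace ℝ F] {p : M}
  {u : Euc m}

lemma mdifferentiable_chartAt (p : M) : (chartAt (Euc m) p).MDifferentiable (𝓡 m) (𝓡 m) :=
  have := IsManifold.of_le (I := 𝓡 m) (M := M) (m := 1) (n := ∞) (by norm_cast)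
  mdifferentiable_chart p

lemma contMDiffAt_chartAt_symm (hu : u ∈ (chartAt (Euc m) p).target) :
    ContMDiffAt (𝓡 m) (𝓡 m) ∞ (chartAt (Euc m) p).symm u :=
  contMDiffOn_chart_symm.contMDiffAt ((chartAt (Euc m) p).open_target.mem_nhds hu)

lemma contDiffAt_comp_chartAt_symm {g : M → F} (hu : u ∈ (chartAt (Euc m) p).target)
    (hg : ContMDiffAt (𝓡 m) 𝓘(ℝ, F) ∞ g ((chartAt (Euc m) p).symm u)) :
    ContDiffAt ℝ ∞ (g ∘ (chartAt (Euc m) p).symm) u :=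
  contMDiffAt_iff_contDiffAt.1 (hg.comp u (contMDiffAt_chartAt_symm hu))

lemma injective_fderiv_comp_chartAt_symm_iff {f : M → F}
    (hu : u ∈ (chartAt (Euc m) p).target)
    (hf : MDifferentiableAt (𝓡 m) 𝓘(ℝ, F) f ((chartAt (Euc m) p).symm u)) :
    Function.Injective (fderiv ℝ (f ∘ (chartAt (Euc m) p).symm) u) ↔
      Function.Injective (mfderiv (𝓡 m) 𝓘(ℝ, F) f ((chartAt (Euc m) p).symm u)) := by
  have hcomp : (fderiv ℝ (f ∘ (chartAt (Euc m) p).symm) u : Euc m → F) =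
      mfderiv (𝓡 m) 𝓘(ℝ, F) f ((chartAt (Euc m) p).symm u) ∘
        mfderiv (𝓡 m) (𝓡 m) (chartAt (Euc m) p).symm u :=
    funext fun V =>
      fderiv_comp_mfderiv hf ((mdifferentiable_chartAt p).mdifferentiableAt_symm hu) V
  rw [hcomp]
  exact Function.Injective.of_comp_iff' _ ((mdifferentiable_chartAt p).symm.mfderiv_bijective hu)

lemma mfderiv_symm_mfderiv_chartAt {q : M} (hq : q ∈ (chartAt (Euc m) p).source)
    (v : TangentSpace (𝓡 m) q) :
    mfderiv (𝓡 m) (𝓡 m) (chartAt (Euc m) p).symm (chartAt (Euc m) p q)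
      (mfderiv (𝓡 m) (𝓡 m) (chartAt (Euc m) p) q v) = v :=
  congrArg (fun L : TangentSpace (𝓡 m) q →L[ℝ] TangentSpace (𝓡 m) q => L v)
    ((mdifferentiable_chartAt p).symm_comp_deriv hq)

lemma mfderiv_eq_fderiv_comp_chartAt_symm {g : M → F} {q : M}
    (hq : q ∈ (chartAt (Euc m) p).source) (hg : MDifferentiableAt (𝓡 m) 𝓘(ℝ, F) g q)
    (v : TangentSpace (𝓡 m) q) :
    mfderiv (𝓡 m) 𝓘(ℝ, F) g q v = fderiv ℝ (g ∘ (chartAt (Euc m) p).symm) (chartAt (Euc m) p q)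
      (mfderiv (𝓡 m) (𝓡 m) (chartAt (Euc m) p) q v) := by
  have hleft := (chartAt (Euc m) p).left_inv hq
  refine Eq.trans ?_ (fderiv_comp_mfderiv (f := g) (by rwa [hleft])
    ((mdifferentiable_chartAt p).mdifferentiableAt_symm ((chartAt (Euc m) p).map_source hq))
    _).symm
  rw [mfderiv_symm_mfderiv_chartAt hq, hleft]

lemma mdifferentiableAt_mfderiv_chartAt_apply {O : Set M} (hO : IsOpen O) (hp : p ∈ O)
    {η : ∀ x : M, TangentSpace (𝓡 m) x}
    (hη : ContMDiffOn (𝓡 m) (𝓡 m).tangent ∞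
      (fun x => (⟨x, η x⟩ : TangentBundle (𝓡 m) M)) O) :
    MDifferentiableAt (𝓡 m) (𝓡 m) (fun q =>
      (mfderiv (𝓡 m) (𝓡 m) (chartAt (Euc m) p) q (η q) : Euc m)) p := by
  have hcoord :=
    (Bundle.contMDiffAt_section (F := Euc m) p).1 (hη.contMDiffAt (hO.mem_nhds hp))
  refine (hcoord.mdifferentiableAt (by simp)).congr_of_eventuallyEq ?_
  have := IsManifold.of_le (I := 𝓡 m) (M := M) (m := 1) (n := ∞) (by norm_cast)
  filter_upwards [(chartAt (Euc m) p).open_source.mem_nhds (mem_chart_source _ p)] with q hq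
  have htriv := TangentBundle.continuousLinearMapAt_trivializationAt (I := 𝓡 m) hq
  have hmf : mfderiv (𝓡 m) (𝓡 m) (chartAt (Euc m) p) q (η q) =
      (trivializationAt (Euc m) (TangentSpace (𝓡 m)) p).continuousLinearMapAt ℝ q (η q) := by
    rw [htriv]
    rfl
  rw [hmf, Bundle.Trivialization.continuousLinearMapAt_apply,
    Bundle.Trivialization.linearMapAt_apply, if_pos (by simpa using hq)]

end Chart

section NormalChange

variable {n : ℕ}

lemma det_jacobianMatrix_smul (A : Euc n →L[ℝ] Euc (n + 1)) (s : ℝ) (v : Euc (n + 1)) :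
    (jacobianMatrix A (s • v)).det = s * (jacobianMatrix A v).det := by
  have hrow : ∀ w : Euc (n + 1), jacobianMatrix A w =
      (jacobianMatrix A 0).updateRow (Fin.last n) w.ofLp := fun w => by
    ext i j
    refine Fin.lastCases ?_ (fun a => ?_) i <;> simp [jacobianMatrix, Matrix.updateRow_apply]
  rw [hrow, hrow v, WithLp.ofLp_smul, Matrix.det_updateRow_smul]

lemma det_jacobianMatrix_eq_inner_mul {A : Euc n →L[ℝ] Euc (n + 1)} {v v' : Euc (n + 1)}
    (hv : ‖v‖ = 1) (hA : ∀ X, inner ℝ (A X) v = 0) (hv' : v' ≠ 0)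
    (hA' : ∀ X, inner ℝ (A X) v' = 0) :
    (jacobianMatrix A v').det = inner ℝ v v' * (jacobianMatrix A v).det := by
  have hv0 : v ≠ 0 := norm_ne_zero_iff.1 (hv ▸ one_ne_zero)
  by_cases hinj : Function.Injective A
  · have hperp : inner ℝ v (v' - inner ℝ v v' • v) = 0 := by
      rw [inner_sub_right, inner_smul_right, real_inner_self_eq_norm_sq, hv, one_pow, mul_one,
        sub_self]
    obtain ⟨X, hX⟩ : v' - inner ℝ v v' • v ∈ LinearMap.range A.toLinearMap :=
      mem_range_of_inner_eq_zero hinj (linearIndependent_unique_iff (v := fun _ : Unit => v).2 hv0)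
        (by simp) (fun _ X => by rw [real_inner_comm]; exact hA X) fun _ => hperp
    have hX0 : A X = 0 := (inner_self_eq_zero (𝕜 := ℝ)).1 <| by
      nth_rewrite 2 [show A X = v' - inner ℝ v v' • v from hX]
      rw [inner_sub_right, inner_smul_right, hA, hA', mul_zero, sub_zero]
    rw [← det_jacobianMatrix_smul, ← sub_eq_zero.1 (hX.symm.trans hX0)]
  · rw [(det_jacobianMatrix_eq_zero_iff hv' hA').2 hinj,
      (det_jacobianMatrix_eq_zero_iff hv0 hA).2 hinj, mul_zero]

lemma IsUnitNormalAt.fderiv_jacobianDet_ne_zero {g ν ν' : Euc n → Euc (n + 1)} {u : Euc n}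
    (h : IsUnitNormalAt g ν u) (h' : IsUnitNormalAt g ν' u) (hJ : jacobianDet g ν u = 0)
    (hJ' : fderiv ℝ (jacobianDet g ν') u ≠ 0) : fderiv ℝ (jacobianDet g ν) u ≠ 0 := by
  have hmul : jacobianDet g ν' =ᶠ[𝓝 u] fun v => inner ℝ (ν v) (ν' v) * jacobianDet g ν v := by
    filter_upwards [h.eventually, h'.eventually] with v hv hv'
    exact det_jacobianMatrix_eq_inner_mul hv.unit.self_of_nhds hv.normal.self_of_nhds
      hv'.normal_ne_zero hv'.normal.self_of_nhds
  have hd : DifferentiableAt ℝ (jacobianDet g ν) u :=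
    (contDiffAt_jacobianDet (r := 1) (h.contDiffAt.of_le (by norm_num))
      (h.contDiffAt_normal.of_le (by norm_num))).differentiableAt one_ne_zero
  contrapose! hJ'
  rw [hmul.fderiv_eq, fderiv_fun_mul (h.differentiableAt_normal.inner ℝ h'.differentiableAt_normal)
    hd, hJ, hJ', smul_zero, zero_smul, add_zero]

end NormalChange

lemma isCompl_ker_range_of_comp {V V' G D : Type*} [AddCommGroup V] [Module ℝ V]
    [AddCommGroup V'] [Module ℝ V'] [AddCommGroup G] [Module ℝ G] [AddCommGroup D] [Module ℝ D]
    (A : V ≃ₗ[ℝ] V') {B : V' →ₗ[ℝ] G} {C : D →ₗ[ℝ] V}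
    (h : IsCompl (LinearMap.ker (B ∘ₗ A.toLinearMap)) (LinearMap.range C)) :
    IsCompl (LinearMap.ker B) (LinearMap.range (A.toLinearMap ∘ₗ C)) := by
  have hmap : IsCompl ((LinearMap.ker (B ∘ₗ A.toLinearMap)).map A.toLinearMap)
      ((LinearMap.range C).map A.toLinearMap) := (Submodule.orderIsoMapComap A).isCompl h
  rwa [LinearMap.ker_comp, Submodule.map_comap_eq_of_surjective A.surjective,
    ← LinearMap.range_comp] at hmap

section Front

variable {m : ℕ} {M : Type*} [TopologicalSpace M] [ChartedSpace (Euc m) M]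
  [IsManifold (𝓡 m) ∞ M] {f ν : M → Euc (m + 1)} {U : Set M} {p : M} {u : Euc m}

namespace IsUnitNormal

lemma isUnitNormalAt (hν : IsUnitNormal f ν U) (hf : ContMDiff (𝓡 m) (𝓡 (m + 1)) ∞ f)
    (hU : IsOpen U) (hu : u ∈ (chartAt (Euc m) p).target)
    (huU : (chartAt (Euc m) p).symm u ∈ U) :
    IsUnitNormalAt (f ∘ (chartAt (Euc m) p).symm) (ν ∘ (chartAt (Euc m) p).symm) u where
  contDiffAt := (contDiffAt_comp_chartAt_symm hu hf.contMDiffAt).of_le (by norm_cast)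
  contDiffAt_normal := (contDiffAt_comp_chartAt_symm hu
    (hν.smooth.contMDiffAt (hU.mem_nhds huU))).of_le (by norm_cast)
  unit := by
    filter_upwards [((chartAt (Euc m) p).continuousAt_symm hu).eventually (hU.mem_nhds huU)]
      with v hv using hν.unit _ hv
  normal := by
    filter_upwards [(chartAt (Euc m) p).open_target.mem_nhds hu,
      ((chartAt (Euc m) p).continuousAt_symm hu).eventually (hU.mem_nhds huU)] with v hv hvU X
    rw [fderiv_comp_mfderiv (hf.mdifferentiable (by simp) _)
      ((mdifferentiable_chartAt p).mdifferentiableAt_symm hv)]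
    exact hν.normal _ hvU _

lemma jacobianDet_eq_zero_iff (hν : IsUnitNormal f ν U)
    (hf : ContMDiff (𝓡 m) (𝓡 (m + 1)) ∞ f) (hU : IsOpen U)
    (hu : u ∈ (chartAt (Euc m) p).target) (huU : (chartAt (Euc m) p).symm u ∈ U) :
    jacobianDet (f ∘ (chartAt (Euc m) p).symm) (ν ∘ (chartAt (Euc m) p).symm) u = 0 ↔
      (chartAt (Euc m) p).symm u ∈ singularSet f := by
  have h := hν.isUnitNormalAt hf hU hu huU
  exact (det_jacobianMatrix_eq_zero_iff h.normal_ne_zero h.normal.self_of_nhds).trans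
    (injective_fderiv_comp_chartAt_symm_iff hu (hf.mdifferentiable (by simp) _)).not

lemma eventually_jacobianDet_comp_eq_zero {k : ℕ} {W : Set (Euc k)} {γ : Euc k → M} {w : Euc k}
    (hν : IsUnitNormal f ν U) (hf : ContMDiff (𝓡 m) (𝓡 (m + 1)) ∞ f) (hU : IsOpen U)
    (hγ : IsLocalParam m k (singularSet f) W γ) (hw : w ∈ W)
    (hp : γ w ∈ (chartAt (Euc m) p).source) (hwU : γ w ∈ U) :
    ∀ᶠ x in 𝓝 w, jacobianDet (f ∘ (chartAt (Euc m) p).symm) (ν ∘ (chartAt (Euc m) p).symm)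
      (chartAt (Euc m) p (γ x)) = 0 := by
  have hcont := (hγ.contMDiffAt hw).continuousAt
  filter_upwards [hγ.isOpen.mem_nhds hw,
    hcont.eventually ((chartAt (Euc m) p).open_source.mem_nhds hp),
    hcont.eventually (hU.mem_nhds hwU)] with x hxW hx hxU
  have hleft := (chartAt (Euc m) p).left_inv hx
  refine (hν.jacobianDet_eq_zero_iff hf hU ((chartAt (Euc m) p).map_source hx) ?_).2 ?_
  · rwa [hleft]
  · rw [hleft]
    exact hγ.mem hxW

end IsUnitNormal

lemma eq_zero_of_fderiv_comp_chartAt_symm_eq_zero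
    (hf : MDifferentiableAt (𝓡 m) (𝓡 (m + 1)) f p) (hν : MDifferentiableAt (𝓡 m) (𝓡 (m + 1)) ν p)
    (hinj : Function.Injective
      (mfderiv (𝓡 m) 𝓘(ℝ, Euc (m + 1) × Euc (m + 1)) (fun y => (f y, ν y)) p)) {X : Euc m}
    (hfX : fderiv ℝ (f ∘ (chartAt (Euc m) p).symm) (chartAt (Euc m) p p) X = 0)
    (hνX : fderiv ℝ (ν ∘ (chartAt (Euc m) p).symm) (chartAt (Euc m) p p) X = 0) : X = 0 := by
  have hu : chartAt (Euc m) p p ∈ (chartAt (Euc m) p).target :=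
    (chartAt (Euc m) p).map_source (mem_chart_source _ p)
  have hleft := (chartAt (Euc m) p).left_inv (mem_chart_source _ p)
  have hsymm := (mdifferentiable_chartAt p).mdifferentiableAt_symm hu
  rw [← hleft] at hf hν hinj
  have hinj' := (injective_fderiv_comp_chartAt_symm_iff hu (hf.prodMk_space hν)).2 hinj
  refine hinj' (Eq.trans ?_ (map_zero _).symm)
  have hpair := DifferentiableAt.fderiv_prodMk (hf.comp _ hsymm).differentiableAt
    (hν.comp _ hsymm).differentiableAt
  exact (congrArg (fun L : Euc m →L[ℝ] Euc (m + 1) × Euc (m + 1) => L X) hpair).trans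
    (Prod.ext hfX hνX)

lemma isLocalParam_chartAt_symm_compl_singularSet (hf : ContMDiff (𝓡 m) (𝓡 (m + 1)) ∞ f)
    (p : M) :
    IsLocalParam m m (singularSet f)ᶜ ((chartAt (Euc m) p).target ∩
      {u | Function.Injective (fderiv ℝ (f ∘ (chartAt (Euc m) p).symm) u)})
      (chartAt (Euc m) p).symm := by
  have hreg : ∀ u ∈ (chartAt (Euc m) p).target,
      Function.Injective (fderiv ℝ (f ∘ (chartAt (Euc m) p).symm) u) ↔
        (chartAt (Euc m) p).symm u ∈ (singularSet f)ᶜ := fun u hu =>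
    (injective_fderiv_comp_chartAt_symm_iff hu (hf.mdifferentiable (by simp) _)).trans
      not_not.symm
  have hcont : ContDiffOn ℝ ∞ (f ∘ (chartAt (Euc m) p).symm) (chartAt (Euc m) p).target :=
    fun u hu => (contDiffAt_comp_chartAt_symm hu hf.contMDiffAt).contDiffWithinAt
  refine IsLocalParam.of_leftInvOn (h := chartAt (Euc m) p) ?_
    (contMDiffOn_chart_symm.mono Set.inter_subset_left)
    (fun u hu => (mdifferentiable_chartAt p).mdifferentiableAt
      ((chartAt (Euc m) p).map_target hu.1))
    (fun u hu => (chartAt (Euc m) p).right_inv hu.1)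
    ⟨(chartAt (Euc m) p).source, (chartAt (Euc m) p).open_source, ?_⟩
  · exact (hcont.continuousOn_fderiv_of_isOpen (chartAt (Euc m) p).open_target
      (by simp)).isOpen_inter_preimage (chartAt (Euc m) p).open_target
        ContinuousLinearMap.isOpen_injective
  · ext q
    constructor
    · rintro ⟨u, ⟨hu, hinj⟩, rfl⟩
      exact ⟨(hreg u hu).1 hinj, (chartAt (Euc m) p).map_target hu⟩
    · rintro ⟨hqS, hq⟩
      have hleft := (chartAt (Euc m) p).left_inv hq
      have hu := (chartAt (Euc m) p).map_source hq
      exact ⟨chartAt (Euc m) p q, ⟨hu, (hreg _ hu).2 (by rwa [hleft])⟩, hleft⟩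

lemma isCompl_ker_fderiv_range_fderiv_chartAt {k : ℕ} {γ : Euc k → M} {x : Euc k}
    (hf : MDifferentiableAt (𝓡 m) (𝓡 (m + 1)) f (γ x))
    (hγ : MDifferentiableAt (𝓡 k) (𝓡 m) γ x) (hx : γ x ∈ (chartAt (Euc m) p).source)
    (h : IsCompl (LinearMap.ker (mfderiv (𝓡 m) (𝓡 (m + 1)) f (γ x)).toLinearMap)
      (LinearMap.range (mfderiv (𝓡 k) (𝓡 m) γ x).toLinearMap)) :
    IsCompl
      (LinearMap.ker (fderiv ℝ (f ∘ (chartAt (Euc m) p).symm)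
        ((chartAt (Euc m) p ∘ γ) x)).toLinearMap)
      (LinearMap.range (fderiv ℝ (chartAt (Euc m) p ∘ γ) x).toLinearMap) := by
  have hφ := mdifferentiable_chartAt (m := m) p
  have hB : (mfderiv (𝓡 m) (𝓡 (m + 1)) f (γ x)).toLinearMap =
      (fderiv ℝ (f ∘ (chartAt (Euc m) p).symm) (chartAt (Euc m) p (γ x))).toLinearMap ∘ₗ
        (hφ.mfderiv hx).toLinearEquiv.toLinearMap :=
    LinearMap.ext fun V => mfderiv_eq_fderiv_comp_chartAt_symm hx hf V
  have hC : (fderiv ℝ (chartAt (Euc m) p ∘ γ) x).toLinearMap =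
      (hφ.mfderiv hx).toLinearEquiv.toLinearMap ∘ₗ
        (mfderiv (𝓡 k) (𝓡 m) γ x).toLinearMap :=
    LinearMap.ext fun V => fderiv_comp_mfderiv (hφ.mdifferentiableAt hx) hγ V
  rw [hB] at h
  rw [hC]
  exact isCompl_ker_range_of_comp _ h

end Front

lemma eventuallyEq_comp_chartAt {X H M N : Type*} [TopologicalSpace X] [TopologicalSpace H]
    [TopologicalSpace M] [ChartedSpace H M] {γ : X → M} {w : X} (f : M → N)
    (hγ : ContinuousAt γ w) :
    f ∘ γ =ᶠ[𝓝 w] (f ∘ (chartAt H (γ w)).symm) ∘ chartAt H (γ w) ∘ γ := by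
  filter_upwards [hγ.eventually
    ((chartAt H (γ w)).open_source.mem_nhds (mem_chart_source _ _))] with x hx
  simp only [Function.comp_apply, (chartAt H (γ w)).left_inv hx]

lemma SectionalCurvatureOn.mono {m n : ℕ} {M : Type*} [TopologicalSpace M]
    [ChartedSpace (Euc m) M] {f : M → Euc (m + 1)} {S : Set M} {P Q : ℝ → Prop}
    (h : SectionalCurvatureOn f n S P) (hPQ : ∀ K, P K → Q K) : SectionalCurvatureOn f n S Q :=
  fun W γ hγ w hw X Y hXY => hPQ _ (h W γ hγ w hw X Y hXY)

section Main

variable {k : ℕ} {M : Type*} [TopologicalSpace M] [ChartedSpace (Euc (k + 1)) M]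
  [IsManifold (𝓡 (k + 1)) ∞ M] {f : M → Euc (k + 1 + 1)} {W : Set (Euc k)} {γ : Euc k → M}
  {w : Euc k}

lemma exists_isLocalParam_of_isNonDegenerate (hf : ContMDiff (𝓡 (k + 1)) (𝓡 (k + 1 + 1)) ∞ f)
    {p : M} (hp : IsNonDegenerate f p) :
    ∃ (W : Set (Euc k)) (γ : Euc k → M), IsLocalParam (k + 1) k (singularSet f) W γ ∧
      p ∈ γ '' W := by
  obtain ⟨hpS, U, ν, hU, hpU, hν, hdJ⟩ := hp
  set φ := chartAt (Euc (k + 1)) p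
  have hpφ : p ∈ φ.source := mem_chart_source _ p
  have hB : IsOpen (φ.target ∩ φ.symm ⁻¹' U) := φ.isOpen_inter_preimage_symm hU
  have hpB : φ p ∈ φ.target ∩ φ.symm ⁻¹' U :=
    ⟨φ.map_source hpφ, by rwa [Set.mem_preimage, φ.left_inv hpφ]⟩
  have hJ : ContDiffOn ℝ ∞ (jacobianDet (f ∘ φ.symm) (ν ∘ φ.symm))
      (φ.target ∩ φ.symm ⁻¹' U) := fun u hu =>
    (contDiffAt_jacobianDet (r := ∞) (contDiffAt_comp_chartAt_symm hu.1 hf.contMDiffAt)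
      (contDiffAt_comp_chartAt_symm hu.1
        (hν.smooth.contMDiffAt (hU.mem_nhds hu.2)))).contDiffWithinAt
  obtain ⟨e, hpe, heB, he, hesymm, hsnd⟩ := exists_openPartialHomeomorph_snd_eq (k := k)
    (by simp) (by simp) hB hJ hpB hdJ
  have hmemB : ∀ q ∈ (φ ≫ₕ e).source, φ q ∈ φ.target ∩ φ.symm ⁻¹' U := fun q hq => heB hq.2
  have hS : ∀ q ∈ (φ ≫ₕ e).source, q ∈ singularSet f ↔ ((φ ≫ₕ e) q).2 = 0 := fun q hq => by
    rw [OpenPartialHomeomorph.coe_trans, Function.comp_apply, hsnd,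
      hν.jacobianDet_eq_zero_iff hf hU (hmemB q hq).1 (hmemB q hq).2, φ.left_inv hq.1]
  have hpψ : p ∈ (φ ≫ₕ e).source := ⟨hpφ, hpe⟩
  have hψp : (((φ ≫ₕ e) p).1, 0) = (φ ≫ₕ e) p := Prod.ext rfl ((hS p hpψ).1 hpS).symm
  refine ⟨_, _, IsLocalParam.of_sliceChart (φ ≫ₕ e) (fun q hq => ?_) ?_ hS,
    ((φ ≫ₕ e) p).1, ?_, ?_⟩
  · have heq : DifferentiableAt ℝ e (φ q) :=
      (he.contDiffAt (e.open_source.mem_nhds hq.2)).differentiableAt (by simp)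
    exact MDifferentiableAt.comp (g := e) q heq.mdifferentiableAt
      ((mdifferentiable_chartAt p).mdifferentiableAt hq.1)
  · exact contMDiffOn_chart_symm.comp (hesymm.mono fun y hy => hy.1).contMDiffOn fun y hy => hy.2
  · rw [Set.mem_preimage, hψp]
    exact (φ ≫ₕ e).map_source hpψ
  · simp only [hψp, (φ ≫ₕ e).left_inv hpψ]

lemma exists_isA2ParamAt (hf : IsFront f) (hA : ∀ p ∈ singularSet f, IsA2Point f p)
    (hγ : IsLocalParam (k + 1) k (singularSet f) W γ) (hw : w ∈ W) :
    ∃ ν : M → Euc (k + 1 + 1), IsA2ParamAt (f ∘ (chartAt (Euc (k + 1)) (γ w)).symm)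
      (ν ∘ (chartAt (Euc (k + 1)) (γ w)).symm) (chartAt (Euc (k + 1)) (γ w) ∘ γ) w := by
  obtain ⟨U, ν, hU, hpU, hν, himm⟩ := hf.2 (γ w)
  obtain ⟨⟨_, U', ν', hU', hpU', hν', hdJ'⟩, -⟩ := hA _ (hγ.mem hw)
  set φ := chartAt (Euc (k + 1)) (γ w)
  have hsrc : γ w ∈ φ.source := mem_chart_source _ _
  have hu : φ (γ w) ∈ φ.target := φ.map_source hsrc
  have hleft : φ.symm (φ (γ w)) = γ w := φ.left_inv hsrc
  have hfd := hf.1.mdifferentiable (by simp)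
  have hνu := hν.isUnitNormalAt hf.1 hU hu (by rwa [hleft])
  have hγsrc : ∀ᶠ x in 𝓝 w, γ x ∈ φ.source :=
    (hγ.contMDiffAt hw).continuousAt.eventually (φ.open_source.mem_nhds hsrc)
  have hsing := hν.eventually_jacobianDet_comp_eq_zero hf.1 hU hγ hw hsrc hpU
  refine ⟨ν, hνu, ?_, ?_, ?_, hsing, ?_, ?_⟩
  · exact fun X hfX hνX => eq_zero_of_fderiv_comp_chartAt_symm_eq_zero (hfd _)
      ((hν.smooth.contMDiffAt (hU.mem_nhds hpU)).mdifferentiableAt (by simp)) (himm _ hpU) hfX hνX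
  · refine ContDiffAt.of_le (n := ∞) (contMDiffAt_iff_contDiffAt.1 ?_) (by norm_cast)
    exact (contMDiffOn_chart.contMDiffAt (φ.open_source.mem_nhds hsrc)).comp w (hγ.contMDiffAt hw)
  · have hcomp : ⇑(fderiv ℝ (φ ∘ γ) w) =
        mfderiv (𝓡 (k + 1)) (𝓡 (k + 1)) φ (γ w) ∘ mfderiv (𝓡 k) (𝓡 (k + 1)) γ w :=
      funext fun V => fderiv_comp_mfderiv
        ((mdifferentiable_chartAt (γ w)).mdifferentiableAt hsrc) (hγ.mdifferentiableAt hw) V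
    rw [hcomp]
    exact ((mdifferentiable_chartAt (γ w)).mfderiv_injective hsrc).comp (hγ.immersion w hw)
  · exact hνu.fderiv_jacobianDet_ne_zero (hν'.isUnitNormalAt hf.1 hU' hu (by rwa [hleft]))
      hsing.self_of_nhds hdJ'
  · filter_upwards [hγ.isOpen.mem_nhds hw, hγsrc] with x hxW hx
    exact isCompl_ker_fderiv_range_fderiv_chartAt (hfd _) (hγ.mdifferentiableAt hxW) hx
      ((hA _ (hγ.mem hxW)).2 W γ hγ x hxW rfl)

lemma injective_fderiv_comp_of_isLocalParam (hf : IsFront f)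
    (hA : ∀ p ∈ singularSet f, IsA2Point f p)
    (hγ : IsLocalParam (k + 1) k (singularSet f) W γ) (hw : w ∈ W) :
    Function.Injective (fderiv ℝ (f ∘ γ) w) := by
  obtain ⟨ν, hν⟩ := exists_isA2ParamAt hf hA hγ hw
  rw [(eventuallyEq_comp_chartAt (H := Euc (k + 1)) f (hγ.contMDiffAt hw).continuousAt).fderiv_eq]
  exact hν.injective_fderiv_comp

lemma sectionalCurvature_nonneg_and_pos (hf : IsFront f)
    (hA : ∀ p ∈ singularSet f, IsA2Point f p)
    (hγ : IsLocalParam (k + 1) k (singularSet f) W γ) (hw : w ∈ W) {Z : ℝ → Euc (k + 1)}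
    (hZ : DifferentiableAt ℝ Z 0) (hZ0 : Z 0 ≠ 0)
    (hnull : fderiv ℝ (f ∘ (chartAt (Euc (k + 1)) (γ w)).symm)
      (chartAt (Euc (k + 1)) (γ w) (γ w)) (Z 0) = 0) {δ : ℝ} (hδ : 0 ≤ δ)
    (hK : ∀ᶠ t : ℝ in 𝓝 0,
      chartAt (Euc (k + 1)) (γ w) (γ w) + t • Z 0 ∈ (chartAt (Euc (k + 1)) (γ w)).target ∩
        {u | Function.Injective (fderiv ℝ (f ∘ (chartAt (Euc (k + 1)) (γ w)).symm) u)} →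
      ∀ Y, LinearIndependent ℝ ![Y, Z t] →
        δ ≤ sectionalCurvature (pullbackMetric (f ∘ (chartAt (Euc (k + 1)) (γ w)).symm))
          (chartAt (Euc (k + 1)) (γ w) (γ w) + t • Z 0) Y (Z t))
    {X Y : Euc k} (hXY : LinearIndependent ℝ ![X, Y]) :
    0 ≤ sectionalCurvature (pullbackMetric (f ∘ γ)) w X Y ∧
      (0 < δ → 0 < sectionalCurvature (pullbackMetric (f ∘ γ)) w X Y) := by
  obtain ⟨ν, hν⟩ := exists_isA2ParamAt hf hA hγ hw
  rw [sectionalCurvature_congr (pullbackMetric_congr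
    (eventuallyEq_comp_chartAt (H := Euc (k + 1)) f (hγ.contMDiffAt hw).continuousAt))]
  refine hν.sectionalCurvature_comp_nonneg_and_pos hZ0 hnull hZ rfl hδ ?_ hXY
  have htarget := (tendsto_line (chartAt (Euc (k + 1)) (γ w) (γ w)) (Z 0)).eventually
    ((chartAt (Euc (k + 1)) (γ w)).open_target.mem_nhds
      ((chartAt (Euc (k + 1)) (γ w)).map_source (mem_chart_source _ _)))
  filter_upwards [hν.eventually_injective_fderiv_line hZ0 hnull, hK.filter_mono nhdsWithin_le_nhds,
    htarget.filter_mono nhdsWithin_le_nhds] with t hinj hKt ht using hKt ⟨ht, hinj⟩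

theorem sectionalCurvatureOn_singularSet (hf : IsFront f)
    (hA : ∀ p ∈ singularSet f, IsA2Point f p) {δ : ℝ} (hδ : 0 ≤ δ)
    (hK : SectionalCurvatureOn f (k + 1) (singularSet f)ᶜ (fun K => δ ≤ K)) :
    SectionalCurvatureOn f k (singularSet f) (fun K => 0 ≤ K ∧ (0 < δ → 0 < K)) := by
  intro W γ hγ w hw X Y hXY
  obtain ⟨ν, hν⟩ := exists_isA2ParamAt hf hA hγ hw
  obtain ⟨η, hη0, hη⟩ := hν.exists_null
  refine sectionalCurvature_nonneg_and_pos hf hA hγ hw (Z := fun _ => η)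
    (differentiableAt_const η) hη0 hη hδ (Eventually.of_forall fun t ht Y hY => ?_) hXY
  exact hK _ _ (isLocalParam_chartAt_symm_compl_singularSet hf.1 (γ w)) _ ht Y η hY

theorem sectionalCurvatureOn_singularSet_pos_of_nullCurvatureGE (hf : IsFront f)
    (hA : ∀ p ∈ singularSet f, IsA2Point f p)
    (hK : ∀ p ∈ singularSet f, ∃ (O : Set M) (η : ∀ x : M, TangentSpace (𝓡 (k + 1)) x) (δ : ℝ),
      IsOpen O ∧ p ∈ O ∧ 0 < δ ∧ IsExtendedNullField f O η ∧ NullCurvatureGE f O η δ) :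
    SectionalCurvatureOn f k (singularSet f) (fun K => 0 < K) := by
  intro W γ hγ w hw X Y hXY
  have hS : γ w ∈ singularSet f := hγ.mem hw
  obtain ⟨O, η, δ, hO, hpO, hδ, hη, hKη⟩ := hK _ hS
  set φ := chartAt (Euc (k + 1)) (γ w)
  have hsrc : γ w ∈ φ.source := mem_chart_source _ _
  have hleft : φ.symm (φ (γ w)) = γ w := φ.left_inv hsrc
  have hsymm := (mdifferentiable_chartAt (γ w)).mdifferentiableAt_symm (φ.map_source hsrc)
  set ζ : M → Euc (k + 1) := fun q => mfderiv (𝓡 (k + 1)) (𝓡 (k + 1)) φ q (η q)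
  set Z : ℝ → Euc (k + 1) := fun t => ζ (φ.symm (φ (γ w) + t • ζ (γ w))) with hZdef
  have hZ0 : Z 0 = ζ (γ w) := by simp only [hZdef, zero_smul, add_zero, hleft]
  have hZ : DifferentiableAt ℝ Z 0 := by
    have hζd : MDifferentiableAt (𝓡 (k + 1)) (𝓡 (k + 1)) ζ (φ.symm (φ (γ w))) := by
      rw [hleft]
      exact mdifferentiableAt_mfderiv_chartAt_apply hO hpO hη.smooth
    refine DifferentiableAt.comp (g := ζ ∘ φ.symm) (0 : ℝ) ?_
      (hasDerivAt_line (φ (γ w)) (ζ (γ w))).differentiableAt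
    rw [zero_smul, add_zero]
    exact (hζd.comp _ hsymm).differentiableAt
  have hζ0 : ζ (γ w) ≠ 0 := fun h => hη.ne_zero _ ⟨hpO, hS⟩
    ((mdifferentiable_chartAt (γ w)).mfderiv_injective hsrc (h.trans (map_zero _).symm))
  have hnull : fderiv ℝ (f ∘ φ.symm) (φ (γ w)) (ζ (γ w)) = 0 :=
    (mfderiv_eq_fderiv_comp_chartAt_symm hsrc (hf.1.mdifferentiable (by simp) _) _).symm.trans
      (hη.null _ ⟨hpO, hS⟩)
  have hOev : ∀ᶠ t : ℝ in 𝓝 0, φ.symm (φ (γ w) + t • ζ (γ w)) ∈ O :=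
    (tendsto_line _ _).eventually (hsymm.continuousAt.preimage_mem_nhds
      (hO.mem_nhds (by rwa [hleft])))
  refine (sectionalCurvature_nonneg_and_pos hf hA hγ hw hZ (hZ0 ▸ hζ0) (by rwa [hZ0]) hδ.le ?_
    hXY).2 hδ
  filter_upwards [hOev] with t htO ht Y hY
  rw [hZ0] at ht ⊢
  refine hKη _ _ (isLocalParam_chartAt_symm_compl_singularSet hf.1 (γ w)) _ ht htO Y (Z t) ?_ hY
  have hpush := mfderiv_symm_mfderiv_chartAt (p := γ w) (φ.map_target ht.1)
    (η (φ.symm (φ (γ w) + t • ζ (γ w))))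
  rwa [φ.right_inv ht.1] at hpush

end Main

end WaveFront

theorem corollary0_general {k : ℕ} {M : Type*} [TopologicalSpace M]
    [ChartedSpace (Euc (k + 1)) M] [IsManifold (𝓡 (k + 1)) ∞ M]
    {f : M → Euc (k + 1 + 1)} (hf : IsFront f) (hA : ∀ p ∈ singularSet f, IsA2Point f p) :
    (IsSubmanifold (k + 1) k (singularSet f) ∧ InducedMetricPosDef f k (singularSet f)) ∧
    (SectionalCurvatureOn f (k + 1) (singularSet f)ᶜ (fun K => 0 ≤ K) →
      SectionalCurvatureOn f k (singularSet f) (fun K => 0 ≤ K)) ∧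
    (∀ δ : ℝ, 0 < δ → SectionalCurvatureOn f (k + 1) (singularSet f)ᶜ (fun K => δ ≤ K) →
      SectionalCurvatureOn f k (singularSet f) (fun K => 0 < K)) ∧
    ((∀ p ∈ singularSet f, ∃ (O : Set M) (η : ∀ x : M, TangentSpace (𝓡 (k + 1)) x) (δ : ℝ),
        IsOpen O ∧ p ∈ O ∧ 0 < δ ∧ IsExtendedNullField f O η ∧ NullCurvatureGE f O η δ) →
      SectionalCurvatureOn f k (singularSet f) (fun K => 0 < K)) :=
  ⟨⟨fun p hp => exists_isLocalParam_of_isNonDegenerate hf.1 (hA p hp).1,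
      fun _ _ hγ _ hw => injective_fderiv_comp_of_isLocalParam hf hA hγ hw⟩,
    fun hK => (sectionalCurvatureOn_singularSet hf hA le_rfl hK).mono fun _ h => h.1,
    fun _ hδ hK => (sectionalCurvatureOn_singularSet hf hA hδ.le hK).mono fun _ h => h.2 hδ,
    sectionalCurvatureOn_singularSet_pos_of_nullCurvatureGE hf hA⟩

theorem corollary0 {m : ℕ} (hm : 3 ≤ m) {M : Type*} [TopologicalSpace M]
    [ChartedSpace (Euc m) M] [IsManifold (𝓡 m) ∞ M]
    (f : M → Euc (m + 1)) (hf : IsFront f) (hA : ∀ p ∈ singularSet f, IsA2Point f p) :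
    -- the singular set is a submanifold, and its induced metric is Riemannian
    (IsSubmanifold m (m - 1) (singularSet f) ∧ InducedMetricPosDef f (m - 1) (singularSet f)) ∧
    -- `K > 0` on the regular set
    (SectionalCurvatureOn f m (singularSet f)ᶜ (fun K => 0 < K) →
      SectionalCurvatureOn f (m - 1) (singularSet f) (fun K => 0 ≤ K)) ∧
    -- `K ≥ δ > 0` on the regular set
    (∀ δ : ℝ, 0 < δ → SectionalCurvatureOn f m (singularSet f)ᶜ (fun K => δ ≤ K) →
      SectionalCurvatureOn f (m - 1) (singularSet f) (fun K => 0 < K)) ∧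
    -- `K ≥ δ > 0`, near each singular point, on the planes containing an extended null vector
    ((∀ p ∈ singularSet f, ∃ (O : Set M) (η : ∀ x : M, TangentSpace (𝓡 m) x) (δ : ℝ),
        IsOpen O ∧ p ∈ O ∧ 0 < δ ∧ IsExtendedNullField f O η ∧ NullCurvatureGE f O η δ) →
      SectionalCurvatureOn f (m - 1) (singularSet f) (fun K => 0 < K)) := by
  obtain ⟨k, rfl⟩ : ∃ k, m = k + 1 := ⟨m - 1, by omega⟩
  exact (corollary0_general hf hA).imp_right (.imp_left fun h hK => h (hK.mono fun _ => le_of_lt))
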